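/- Let $k$ be an infinite field, $S=k[x_1,\ldots,x_n]$ the standard graded polynomial ring, and $S(m)=k[x_1,\ldots,x_m]$ for $m\le n$. For a homogeneous ideal $I$ of $S$ let $\operatorname{gin}(I)$ be its generic initial ideal with respect to the graded reverse lexicographic order with $x_1>x_2>\cdots>x_n$, i.e. the common value of $\operatorname{in}(\alpha(I))$ for all $\alpha$ in some nonempty Zariski open subset of $GL_n(k)$. For a monomial ideal $J\subset S$ with minimal monomial generators $u_1,\ldots,u_m$ let $\Phi_r(J)\subset S$ be the ideal generated by the monomials obtained from $u_1,\ldots,u_m$ by setting $x_{r+1}=\cdots=x_n=1$, and let $\Pi_r(J)\subset S(r)$ be the image of $J$ under the $k$-algebra map $\Pi_r:S\to S(r)$ that sends $x_{r+1},\ldots,x_n$ to $0$ and fixes $x_1,\ldots,x_r$. For a graded quotient ring $A\neq 0$ of a polynomial ring, with Hilbert series $q(t)/(1-t)^{\dim A}$, let $\deg A=q(1)$ be its multiplicity, let $\operatorname{depth}A$ be its depth with respect to its maximal homogeneous ideal, and call $A$ almost Cohen–Macaulay if $\operatorname{depth}A\ge\dim A-1$. Let $P$ be a homogeneous prime ideal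 of $S$, let $d=\dim S/P$, $c=n-d$ and $J=\operatorname{gin}(P)$, and suppose that $$\deg\bigl(S/\Phi_c(J)\bigr)+1=\deg\bigl(S(c)/\Pi_c(J)\bigr).$$ Then $d\ge 1$, $J=(J\cap k[x_1,\ldots,x_{c+1}])S$, and $x_{c+1}$ divides some minimal monomial generator of $J$. Moreover $\operatorname{depth}(S/P)=d-1$, so that $S/P$ is almost Cohen–Macaulay. -/

import Mathlib

open MvPolynomial

noncomputable section

namespace GinDepth

/-! ### The graded reverse lexicographic order

The variable `x_{i+1}` of the text is `X i`, with `i : Fin n`; `x_1 > x_2 > ... > x_n`. -/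

/-- Exponent vectors, to be ordered by the graded reverse lexicographic order. -/
def RevLex (n : ℕ) : Type := Fin n →₀ ℕ

instance (n : ℕ) : AddCommMonoid (RevLex n) := inferInstanceAs (AddCommMonoid (Fin n →₀ ℕ))

/-- The identity map, additively. -/
def toRevLex {n : ℕ} : (Fin n →₀ ℕ) ≃+ RevLex n where
  toFun u := u
  invFun u := u
  left_inv _ := rfl
  right_inv _ := rfl
  map_add' _ _ := rfl

/-- Compare first the total degrees; if these agree, look at the last coordinate in which the two
vectors differ, the vector with the larger entry there being the smaller one. -/
def RevLex.key {n : ℕ} (u : RevLex n) : ℕ ×ₗ Colex (Fin n → ℕᵒᵈ) :=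
  toLex ((toRevLex.symm u).degree, toColex fun i => OrderDual.toDual (toRevLex.symm u i))

theorem RevLex.key_injective {n : ℕ} : Function.Injective (RevLex.key (n := n)) := by
  intro u v h
  have h2 := congrArg (fun p => ofColex (ofLex p).2) h
  exact toRevLex.symm.injective
    (Finsupp.ext fun i => OrderDual.toDual.injective (congrFun h2 i))

instance (n : ℕ) : LinearOrder (RevLex n) := LinearOrder.lift' RevLex.key RevLex.key_injective

theorem RevLex.lt_iff {n : ℕ} {u v : Fin n →₀ ℕ} :
    toRevLex u < toRevLex v ↔
      u.degree < v.degree ∨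
        (u.degree = v.degree ∧ ∃ i, (∀ j, i < j → u j = v j) ∧ v i < u i) := by
  change RevLex.key (toRevLex u) < RevLex.key (toRevLex v) ↔ _
  rw [RevLex.key, RevLex.key, Prod.Lex.toLex_lt_toLex]
  rfl

instance (n : ℕ) : IsOrderedAddMonoid (RevLex n) where
  add_le_add_left u v h w := by
    obtain ⟨u, rfl⟩ := toRevLex.surjective u
    obtain ⟨v, rfl⟩ := toRevLex.surjective v
    obtain ⟨w, rfl⟩ := toRevLex.surjective w
    rcases h.eq_or_lt with h | h
    · rw [h]
    · rw [← map_add, ← map_add]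
      refine le_of_lt (RevLex.lt_iff.2 ?_)
      rcases RevLex.lt_iff.1 h with h | ⟨h, i, h1, h2⟩
      · left
        simpa using h
      · right
        refine ⟨by simp [h], i, fun j hj => by simp [h1 j hj], by simpa using h2⟩

theorem RevLex.monotone {n : ℕ} : Monotone (toRevLex (n := n)) := by
  intro u v h
  rcases eq_or_ne u v with rfl | hne
  · exact le_rfl
  · refine le_of_lt (RevLex.lt_iff.2 (Or.inl ?_))
    obtain ⟨w, rfl⟩ := exists_add_of_le h
    have : w.degree ≠ 0 := by
      intro h0
      exact hne (by simp [(Finsupp.degree_eq_zero_iff w).1 h0])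
    rw [map_add]
    omega

instance (n : ℕ) : WellFoundedLT (RevLex n) := by
  refine ⟨RelEmbedding.wellFounded_iff_isEmpty.2 ⟨fun f => ?_⟩⟩
  obtain ⟨i, j, hij, h⟩ := wellQuasiOrdered_le (fun i => toRevLex.symm (f i))
  exact absurd (RevLex.monotone h) (not_le.2 (f.map_rel_iff.2 hij))

/-- The graded reverse lexicographic order with `x_1 > x_2 > ... > x_n`. -/
def degRevLex (n : ℕ) : MonomialOrder (Fin n) where
  syn := RevLex n
  toSyn := toRevLex
  toSyn_monotone := RevLex.monotone

/-! ### Generic initial ideals -/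

variable {k : Type*} [Field k] {n : ℕ}

/-- The initial ideal with respect to the graded reverse lexicographic order. -/
def initialIdeal (I : Ideal (MvPolynomial (Fin n) k)) : Ideal (MvPolynomial (Fin n) k) :=
  Ideal.span {p | ∃ f ∈ I, f ≠ 0 ∧ p = monomial ((degRevLex n).degree f) 1}

/-- The linear change of coordinates `x_j ↦ ∑ i, α i j • x_i` of the polynomial ring. -/
def coordChange (α : GL (Fin n) k) : MvPolynomial (Fin n) k →ₐ[k] MvPolynomial (Fin n) k :=
  aeval fun j => ∑ i, C ((α : Matrix (Fin n) (Fin n) k) i j) * X i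

/-- `U` is open in the Zariski topology of `GL_n(k)`: it is the locus where not all members of
some family of polynomials in the matrix entries vanish. -/
def IsZariskiOpen (U : Set (GL (Fin n) k)) : Prop :=
  ∃ T : Set (MvPolynomial (Fin n × Fin n) k),
    U = {α : GL (Fin n) k | ∃ F ∈ T, eval (fun p => (α : Matrix (Fin n) (Fin n) k) p.1 p.2) F ≠ 0}

/-- `J` is the common initial ideal of `α(I)` for all `α` in a nonempty Zariski open set. -/
def IsGin (I J : Ideal (MvPolynomial (Fin n) k)) : Prop :=
  ∃ U : Set (GL (Fin n) k), IsZariskiOpen U ∧ U.Nonempty ∧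
    ∀ α ∈ U, initialIdeal (I.map (coordChange α)) = J

open Classical in
/-- The generic initial ideal. Over an infinite field exactly one `J` satisfies `IsGin I J`. -/
def gin (I : Ideal (MvPolynomial (Fin n) k)) : Ideal (MvPolynomial (Fin n) k) :=
  if h : ∃ J, IsGin I J then h.choose else ⊥

/-! ### Monomial ideals -/

/-- The exponents of the monomials that are minimal generators of a monomial ideal `J`: the
monomials of `J` that are minimal under divisibility. -/
def minGens (J : Ideal (MvPolynomial (Fin n) k)) : Set (Fin n →₀ ℕ) :=
  {u | Minimal (fun v => monomial v (1 : k) ∈ J) u}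

/-- `Φ_r(J)`: in every minimal monomial generator of `J`, set `x_{r+1}, ..., x_n` to `1`. -/
def Phi (r : ℕ) (J : Ideal (MvPolynomial (Fin n) k)) : Ideal (MvPolynomial (Fin n) k) :=
  Ideal.span {p | ∃ u ∈ minGens J, p = monomial (u.filter fun i : Fin n => (i : ℕ) < r) 1}

/-- `Π_r : S → S(r)`, which sets `x_{r+1}, ..., x_n` to `0` and keeps `x_1, ..., x_r`. -/
def piHom (k : Type*) [Field k] (n r : ℕ) : MvPolynomial (Fin n) k →ₐ[k] MvPolynomial (Fin r) k :=
  aeval fun i => if h : (i : ℕ) < r then X ⟨i, h⟩ else 0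

/-! ### Homogeneous ideals, Hilbert series, multiplicity, depth -/

attribute [local instance] MvPolynomial.gradedAlgebra in
/-- `I` is homogeneous for the standard grading, in which every variable has degree `1`. -/
def IsHomogeneousIdeal (I : Ideal (MvPolynomial (Fin n) k)) : Prop :=
  I.IsHomogeneous (homogeneousSubmodule (Fin n) k)

/-- The Krull dimension of `S/I` as a natural number (`0` for the zero ring). -/
def dimQuot (I : Ideal (MvPolynomial (Fin n) k)) : ℕ :=
  ((ringKrullDim (MvPolynomial (Fin n) k ⧸ I)).unbotD 0).toNat

/-- The Hilbert function of `S/I` for a homogeneous ideal `I`: the dimension of the degree `m`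
component of `S/I`, which is the image of the forms of degree `m`. -/
def hilbertFunction (I : Ideal (MvPolynomial (Fin n) k)) (m : ℕ) : ℕ :=
  Module.finrank k
    ((homogeneousSubmodule (Fin n) k m).map (Ideal.Quotient.mkₐ k I).toLinearMap)

/-- The Hilbert series of `S/I`. -/
def hilbertSeries (I : Ideal (MvPolynomial (Fin n) k)) : PowerSeries ℤ :=
  PowerSeries.mk fun m => (hilbertFunction I m : ℤ)

open Classical in
/-- The polynomial `q` with Hilbert series `q(t) / (1 - t) ^ dim (S/I)`; it exists for every
homogeneous ideal. -/
def hilbertNumerator (I : Ideal (MvPolynomial (Fin n) k)) : Polynomial ℤ :=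
  if h : ∃ q : Polynomial ℤ,
      (q : PowerSeries ℤ) = hilbertSeries I * (1 - PowerSeries.X) ^ dimQuot I
  then h.choose else 0

/-- The degree (multiplicity) `deg (S/I)`, the Hilbert coefficient `e_0 = q(1)`. -/
def deg (I : Ideal (MvPolynomial (Fin n) k)) : ℤ :=
  (hilbertNumerator I).eval 1

/-- The depth of `S/I` with respect to the maximal homogeneous ideal `(x_1, ..., x_n)`: the
supremum of the lengths of regular sequences on `S/I` inside that ideal. -/
def depthQuot (I : Ideal (MvPolynomial (Fin n) k)) : ℕ∞ :=
  ⨆ rs : {rs : List (MvPolynomial (Fin n) k) //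
      (∀ f ∈ rs, f ∈ idealOfVars (Fin n) k) ∧
        RingTheory.Sequence.IsRegular (MvPolynomial (Fin n) k ⧸ I) rs},
    (rs.1.length : ℕ∞)

/-- The standard graded algebra `S/I` is almost Cohen–Macaulay: `dim ≤ depth + 1`. -/
def IsAlmostCohenMacaulay (I : Ideal (MvPolynomial (Fin n) k)) : Prop :=
  ringKrullDim (MvPolynomial (Fin n) k ⧸ I) ≤ ((depthQuot I + 1 : ℕ∞) : WithBot ℕ∞)

end GinDepth

end

/-!
After a generic change of coordinates `S/P` is finite over the polynomial ring `A` in the last `d`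
variables, and torsion-free since `P` is unmixed. Let `E` be the set of exponents of `gin P`. Both
degrees count exponents in the first `c` variables: `deg (S/Φ_c)` those that are in the projection
of no element of `E`, `deg (S(c)/Π_c)` those not in `E`. The hypothesis thus says that exactly one
`u ∉ E` has a multiple in `E`. The corresponding relations between the standard monomials over `A`
form a saturated submodule on which the coefficient of `x^u` is injective, hence a submodule of
rank one, which is principal because `A` is factorial. So over `u` the set `E` is generated by the
leading exponent of a single polynomial of `A`, which in generic coordinates is a power of
`x_{c+1}`. For the reverse lexicographic order it follows that `x_n, …, x_{c+2}` is a regular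
sequence, modulo which `x_{c+1}` is a zero divisor generating, together with `P`, an ideal primary
to the irrelevant one, so that the depth is `d - 1`.
-/

noncomputable section

namespace GinDepth

theorem ringKrullDim_eq_of_isIntegral_of_injective {R A : Type*} [CommRing R] [CommRing A]
    [Algebra R A] [Algebra.IsIntegral R A] (hinj : Function.Injective (algebraMap R A)) :
    ringKrullDim A = ringKrullDim R := by
  refine le_antisymm
    (Order.krullDim_le_of_strictMono (PrimeSpectrum.comap (algebraMap R A)) fun p q hpq =>
      Ideal.IsIntegral.comap_lt_comap (R := R) (I := p.asIdeal) (J := q.asIdeal) hpq)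
    (iSup_le fun chain => ?_)
  obtain ⟨P, -, hP, hcomap⟩ := Ideal.exists_ideal_over_prime_of_isIntegral (S := A)
    (RelSeries.head chain).asIdeal ⊥ <| by
      rw [← RingHom.ker_eq_comap_bot, (RingHom.injective_iff_ker_eq_bot _).1 hinj]
      exact bot_le
  have : P.LiesOver (RelSeries.head chain).asIdeal := ⟨hcomap.symm⟩
  obtain ⟨lift, hlength, -, -⟩ := Ideal.exists_ltSeries_of_hasGoingUp chain P
  rw [← hlength]
  exact Order.LTSeries.length_le_krullDim lift

/-! ### Regular sequences and depth -/

section Depth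

variable {S : Type*} [CommRing S] {m I : Ideal S} {x y : S}

/-- The socle of `S/I` with respect to `m`, the set of elements annihilated by `m`, is nonzero. -/
def HasSocle (m I : Ideal S) : Prop := ∃ z ∉ I, ∀ a ∈ m, a * z ∈ I

/-- Some `S/I`-regular sequence of length `t` in `m` has a quotient with nonzero socle, and is
therefore a maximal regular sequence in `m`. -/
def HasMaximalRegularSequence (m : Ideal S) : ℕ → Ideal S → Prop
  | 0, I => HasSocle m I
  | t + 1, I => ∃ y ∈ m, IsSMulRegular (S ⧸ I) y ∧
      HasMaximalRegularSequence m t (I ⊔ Ideal.span {y})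

theorem isSMulRegular_quotient_iff : IsSMulRegular (S ⧸ I) x ↔ ∀ a, x * a ∈ I → a ∈ I :=
  isSMulRegular_quotient_iff_mem_of_smul_mem I x

theorem mem_sup_span_singleton {a : S} : a ∈ I ⊔ Ideal.span {y} ↔ ∃ b, a - y * b ∈ I := by
  rw [sup_comm, Ideal.mem_span_singleton_sup]
  constructor
  · rintro ⟨b, i, hi, rfl⟩
    exact ⟨b, by simpa [mul_comm] using hi⟩
  · rintro ⟨b, hb⟩
    exact ⟨b, _, hb, by ring⟩

theorem HasSocle.not_isSMulRegular (h : HasSocle m I) (hx : x ∈ m) :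
    ¬ IsSMulRegular (S ⧸ I) x := by
  obtain ⟨z, hz, hm⟩ := h
  exact fun hr => hz (isSMulRegular_quotient_iff.1 hr z (hm x hx))

theorem HasSocle.exchange (hy : y ∈ m) (hrx : IsSMulRegular (S ⧸ I) x)
    (hry : IsSMulRegular (S ⧸ I) y) (h : HasSocle m (I ⊔ Ideal.span {x})) :
    HasSocle m (I ⊔ Ideal.span {y}) := by
  rw [isSMulRegular_quotient_iff] at hrx hry
  obtain ⟨z, hz, hm⟩ := h
  -- The new socle element is the `w` with `y * z = x * w` modulo `I`.
  obtain ⟨w, hw⟩ := mem_sup_span_singleton.1 (hm y hy)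
  refine ⟨w, fun hwy => hz ?_, fun a ha => ?_⟩
  · obtain ⟨v, hv⟩ := mem_sup_span_singleton.1 hwy
    refine mem_sup_span_singleton.2 ⟨v, hry _ ?_⟩
    convert I.add_mem hw (I.mul_mem_left x hv) using 1
    ring
  · obtain ⟨z', hz'⟩ := mem_sup_span_singleton.1 (hm a ha)
    refine mem_sup_span_singleton.2 ⟨z', hrx _ ?_⟩
    convert I.sub_mem (I.mul_mem_left y hz') (I.mul_mem_left a hw) using 1
    ring

theorem isSMulRegular_quotient_swap (hx : IsSMulRegular (S ⧸ I) x)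
    (hy : IsSMulRegular (S ⧸ (I ⊔ Ideal.span {x})) y) :
    IsSMulRegular (S ⧸ (I ⊔ Ideal.span {y})) x := by
  rw [isSMulRegular_quotient_iff] at hx hy ⊢
  intro b hb
  obtain ⟨a, ha⟩ := mem_sup_span_singleton.1 hb
  obtain ⟨a', ha'⟩ := mem_sup_span_singleton.1 <|
    hy a (mem_sup_span_singleton.2 ⟨b, by simpa using I.neg_mem ha⟩)
  refine mem_sup_span_singleton.2 ⟨a', hx _ ?_⟩
  convert I.add_mem ha (I.mul_mem_left y ha') using 1
  ring

theorem hasSocle_of_mem_associatedPrimes [IsNoetherianRing S] {p : Ideal S}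
    (hp : p ∈ associatedPrimes S (S ⧸ I)) (h : m ≤ p) : HasSocle m I := by
  obtain ⟨hprime, x, hx⟩ := isAssociatedPrime_iff.1 (AssociatedPrimes.mem_iff.1 hp)
  obtain ⟨z, rfl⟩ := Ideal.Quotient.mk_surjective x
  have mem_iff (a : S) : a ∈ p ↔ a * z ∈ I := by
    rw [hx, Submodule.mem_colon_singleton, Submodule.mem_bot, ← Ideal.Quotient.eq_zero_iff_mem]
    rfl
  exact ⟨z, fun hz => hprime.ne_top <| (Ideal.eq_top_iff_one _).2 <|
    (mem_iff 1).2 (by rwa [one_mul]), fun a ha => (mem_iff a).1 (h ha)⟩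

theorem hasSocle_of_not_isSMulRegular [IsNoetherianRing S] (hx : ¬ IsSMulRegular (S ⧸ I) x)
    (hm : m ≤ (I ⊔ Ideal.span {x}).radical) : HasSocle m I := by
  obtain ⟨z, hxz, hz⟩ : ∃ z, x * z ∈ I ∧ z ∉ I := by
    simpa only [isSMulRegular_quotient_iff, not_forall, exists_prop] using hx
  obtain ⟨p, hp, hle⟩ := exists_le_isAssociatedPrime_of_isNoetherianRing S
    (Ideal.Quotient.mk I z) (by rwa [Ne, Ideal.Quotient.eq_zero_iff_mem])
  have mem_of_mul_mem {a : S} (ha : a * z ∈ I) : a ∈ p := by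
    refine hle ?_
    rw [Submodule.mem_colon_singleton, Submodule.mem_bot]
    exact Ideal.Quotient.eq_zero_iff_mem.2 ha
  refine hasSocle_of_mem_associatedPrimes hp (hm.trans ?_)
  rw [Ideal.IsPrime.radical_le_iff hp.isPrime, sup_le_iff, Ideal.span_singleton_le_iff_mem]
  exact ⟨fun a ha => mem_of_mul_mem (I.mul_mem_right z ha), mem_of_mul_mem hxz⟩

theorem exists_isSMulRegular_of_not_hasSocle [IsNoetherianRing S] {s : Set (Ideal S)}
    (hfin : s.Finite) (hs : ∀ I ∈ s, ¬ HasSocle m I) :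
    ∃ z ∈ m, ∀ I ∈ s, IsSMulRegular (S ⧸ I) z := by
  by_contra! h
  let T : Set (Ideal S) := ⋃ I ∈ s, associatedPrimes S (S ⧸ I)
  have hT : T.Finite := hfin.biUnion fun I _ => associatedPrimes.finite S (S ⧸ I)
  have hcover : (m : Set S) ⊆ ⋃ p ∈ T, (p : Set S) := by
    intro z hz
    obtain ⟨I, hI, hr⟩ := h z hz
    have : z ∈ ⋃ p ∈ associatedPrimes S (S ⧸ I), (p : Set S) := by
      rwa [biUnion_associatedPrimes_eq_compl_regular]
    obtain ⟨p, hp, hzp⟩ := Set.mem_iUnion₂.1 this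
    exact Set.mem_iUnion₂.2 ⟨p, Set.mem_iUnion₂.2 ⟨I, hI, hp⟩, hzp⟩
  obtain ⟨p, hpT, hmp⟩ := (Ideal.subset_union_prime_finite hT (f := id) ⊤ ⊤
    (fun p hp _ _ => by
      obtain ⟨I, -, hp⟩ := Set.mem_iUnion₂.1 hp
      exact IsAssociatedPrime.isPrime hp)).1 hcover
  obtain ⟨I, hI, hp⟩ := Set.mem_iUnion₂.1 hpT
  exact hs I hI (hasSocle_of_mem_associatedPrimes hp hmp)

theorem HasMaximalRegularSequence.sup_span_singleton [IsNoetherianRing S] {t : ℕ} (hx : x ∈ m)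
    (hrx : IsSMulRegular (S ⧸ I) x) (h : HasMaximalRegularSequence m (t + 1) I) :
    HasMaximalRegularSequence m t (I ⊔ Ideal.span {x}) := by
  induction t generalizing I x with
  | zero =>
    obtain ⟨y, -, hry, h⟩ := h
    exact h.exchange hx hry hrx
  | succ t ih =>
    obtain ⟨y, hy, hry, h⟩ := h
    have hIy : ¬ HasSocle m (I ⊔ Ideal.span {y}) := fun hs => by
      obtain ⟨y', hy', hry', -⟩ := h
      exact hs.not_isSMulRegular hy' hry'
    -- An element regular modulo `(I, y)` and modulo `(I, x)` links the two quotients.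
    obtain ⟨z, hz, hreg⟩ := exists_isSMulRegular_of_not_hasSocle (m := m)
      (s := {I, I ⊔ Ideal.span {y}, I ⊔ Ideal.span {x}}) (Set.toFinite _) <| by
        rintro K (rfl | rfl | rfl)
        exacts [fun hs => hs.not_isSMulRegular hx hrx, hIy,
          fun hs => hIy (hs.exchange hy hrx hry)]
    have hzy := hreg (I ⊔ Ideal.span {y}) (by simp)
    have hzx := hreg (I ⊔ Ideal.span {x}) (by simp)
    have hmax : HasMaximalRegularSequence m (t + 1) (I ⊔ Ideal.span {z}) := by
      refine ⟨y, hy, isSMulRegular_quotient_swap hry hzy, ?_⟩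
      rw [sup_right_comm]
      exact ih hz hzy h
    refine ⟨z, hz, hzx, ?_⟩
    rw [sup_right_comm]
    exact ih hx (isSMulRegular_quotient_swap hrx hzx) hmax

open scoped Pointwise in
theorem isWeaklyRegular_quotient_cons_iff {xs : List S} :
    RingTheory.Sequence.IsWeaklyRegular (S ⧸ I) (x :: xs) ↔
      IsSMulRegular (S ⧸ I) x ∧
        RingTheory.Sequence.IsWeaklyRegular (S ⧸ (I ⊔ Ideal.span {x})) xs := by
  rw [RingTheory.Sequence.isWeaklyRegular_cons_iff]
  refine and_congr Iff.rfl (LinearEquiv.isWeaklyRegular_congr ?_ xs)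
  have : x • (⊤ : Submodule S (S ⧸ I)) = Submodule.map I.mkQ (I ⊔ Ideal.span {x}) := by
    rw [Submodule.map_sup, Submodule.mkQ_map_self, bot_sup_eq, ← Submodule.range_mkQ I,
      ← Submodule.map_top, ← Submodule.ideal_span_singleton_smul, ← Submodule.map_smul'']
    simp
  exact (Submodule.quotEquivOfEq _ _ this).trans
    (Submodule.quotientQuotientEquivQuotient I (I ⊔ Ideal.span {x}) le_sup_left)

theorem HasMaximalRegularSequence.length_le [IsNoetherianRing S] {xs : List S} {t : ℕ}
    (h : HasMaximalRegularSequence m t I) (hm : ∀ x ∈ xs, x ∈ m)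
    (hr : RingTheory.Sequence.IsWeaklyRegular (S ⧸ I) xs) : xs.length ≤ t := by
  induction xs generalizing t I with
  | nil => exact Nat.zero_le _
  | cons x xs ih =>
    obtain ⟨hrx, hr⟩ := isWeaklyRegular_quotient_cons_iff.1 hr
    obtain ⟨hx, hm⟩ := List.forall_mem_cons.1 hm
    cases t with
    | zero => exact absurd hrx (HasSocle.not_isSMulRegular h hx)
    | succ t => exact Nat.succ_le_succ (ih (h.sup_span_singleton hx hrx) hm hr)

theorem HasMaximalRegularSequence.exists_isWeaklyRegular {t : ℕ}
    (h : HasMaximalRegularSequence m t I) :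
    ∃ xs : List S, xs.length = t ∧ (∀ x ∈ xs, x ∈ m) ∧
      RingTheory.Sequence.IsWeaklyRegular (S ⧸ I) xs := by
  induction t generalizing I with
  | zero => exact ⟨[], rfl, by simp, by simp⟩
  | succ t ih =>
    obtain ⟨y, hy, hry, h⟩ := h
    obtain ⟨xs, hlength, hm, hr⟩ := ih h
    exact ⟨y :: xs, by simp [hlength], List.forall_mem_cons.2 ⟨hy, hm⟩,
      isWeaklyRegular_quotient_cons_iff.2 ⟨hry, hr⟩⟩

theorem HasMaximalRegularSequence.map_equiv {S' : Type*} [CommRing S'] (e : S ≃+* S') {t : ℕ}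
    (h : HasMaximalRegularSequence m t I) :
    HasMaximalRegularSequence (m.map e) t (I.map e) := by
  induction t generalizing I with
  | zero =>
    obtain ⟨z, hz, h⟩ := h
    refine ⟨e z, by rwa [Ideal.apply_mem_of_equiv_iff], e.surjective.forall.2 fun a ha => ?_⟩
    rw [← map_mul, Ideal.apply_mem_of_equiv_iff]
    exact h a (Ideal.apply_mem_of_equiv_iff.1 ha)
  | succ t ih =>
    obtain ⟨y, hy, hry, h⟩ := h
    refine ⟨e y, Ideal.mem_map_of_mem e hy, ?_, ?_⟩
    · rw [isSMulRegular_quotient_iff] at hry ⊢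
      refine e.surjective.forall.2 fun a ha => ?_
      rw [← map_mul, Ideal.apply_mem_of_equiv_iff] at ha
      exact Ideal.mem_map_of_mem e (hry a ha)
    · simpa only [Ideal.map_sup, Ideal.map_span, Set.image_singleton] using ih h

end Depth

section DepthQuot

variable {k : Type*} [Field k] {n : ℕ}

theorem mem_idealOfVars_iff {σ R : Type*} [CommSemiring R] {f : MvPolynomial σ R} :
    f ∈ idealOfVars σ R ↔ coeff 0 f = 0 := by
  rw [← pow_one (idealOfVars σ R), mem_pow_idealOfVars_iff']
  simp [Finsupp.degree_eq_zero_iff]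

theorem idealOfVars_ne_top {σ R : Type*} [CommSemiring R] [Nontrivial R] :
    idealOfVars σ R ≠ ⊤ :=
  (Ideal.ne_top_iff_one _).2 fun h => by simp [mem_idealOfVars_iff] at h

theorem depthQuot_eq_of_hasMaximalRegularSequence {I : Ideal (MvPolynomial (Fin n) k)}
    (hI : I ≤ idealOfVars (Fin n) k) {t : ℕ}
    (h : HasMaximalRegularSequence (idealOfVars (Fin n) k) t I) : depthQuot I = t := by
  refine le_antisymm (iSup_le fun rs => ?_) ?_
  · exact_mod_cast h.length_le rs.2.1 rs.2.2.toIsWeaklyRegular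
  · obtain ⟨xs, hlength, hm, hr⟩ := h.exists_isWeaklyRegular
    refine le_iSup_of_le ⟨xs, hm, hr, fun htop => ?_⟩ (by simp [hlength])
    have hsup : I ⊔ Ideal.ofList xs = ⊤ := by
      have := congrArg (Submodule.comap I.mkQ) htop
      rwa [Submodule.comap_top, ← Submodule.range_mkQ I, ← Submodule.map_top,
        ← Submodule.map_smul'', Submodule.comap_map_mkQ, smul_eq_mul, Ideal.mul_top,
        eq_comm] at this
    exact idealOfVars_ne_top (top_le_iff.1 (hsup ▸ sup_le hI (Ideal.span_le.2 hm)))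

end DepthQuot

/-! ### Leading exponents -/

section LeadExps

variable {σ k : Type*} [Field k] {m : MonomialOrder σ} {I : Ideal (MvPolynomial σ k)}

/-- The exponents of the leading monomials of the nonzero elements of `I`. -/
def leadExps (m : MonomialOrder σ) (I : Ideal (MvPolynomial σ k)) : Set (σ →₀ ℕ) :=
  {w | ∃ f ∈ I, f ≠ 0 ∧ m.degree f = w}

theorem isUpperSet_leadExps (m : MonomialOrder σ) (I : Ideal (MvPolynomial σ k)) :
    IsUpperSet (leadExps m I) := by
  classical
  rintro _ w hle ⟨f, hf, hf0, rfl⟩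
  obtain ⟨v, rfl⟩ := exists_add_of_le hle
  have hv : monomial v (1 : k) ≠ 0 := by simp
  refine ⟨f * monomial v 1, I.mul_mem_right _ hf, mul_ne_zero hf0 hv, ?_⟩
  rw [MonomialOrder.degree_mul hf0 hv, MonomialOrder.degree_monomial, if_neg one_ne_zero]

theorem leadExps_mono {I' : Ideal (MvPolynomial σ k)} (h : I ≤ I') :
    leadExps m I ⊆ leadExps m I' :=
  fun _ ⟨f, hf, hf0, hw⟩ => ⟨f, h hf, hf0, hw⟩

theorem degree_eq_of_forall_le {f : MvPolynomial σ k} {w : σ →₀ ℕ} (hw : w ∈ f.support)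
    (hle : ∀ v ∈ f.support, m.toSyn v ≤ m.toSyn w) : m.degree f = w :=
  m.toSyn.injective (le_antisymm (m.degree_le_iff.2 hle) (m.le_degree hw))

theorem mem_leadExps_of_forall_le {f : MvPolynomial σ k} (hf : f ∈ I) {w : σ →₀ ℕ}
    (hw : w ∈ f.support) (hle : ∀ v ∈ f.support, m.toSyn v ≤ m.toSyn w) : w ∈ leadExps m I :=
  ⟨f, hf, by rintro rfl; simp at hw, degree_eq_of_forall_le hw hle⟩

theorem exists_reduction {D : Set (σ →₀ ℕ)} (hD : D ⊆ leadExps m I) (f : MvPolynomial σ k) :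
    ∃ g, f - g ∈ I ∧ ∀ w ∈ g.support, w ∉ D ∧ ∃ v ∈ f.support, m.toSyn w ≤ m.toSyn v := by
  rcases eq_or_ne f 0 with rfl | hf0
  · exact ⟨0, by simp, by simp⟩
  let B : Set (MvPolynomial σ k) := {b | b ∈ I ∧ b ≠ 0 ∧ m.degree b ∈ D}
  obtain ⟨q, g, hfg, hdeg, hg⟩ := m.div_set (B := B)
    (fun b hb => (m.leadingCoeff_ne_zero_iff.2 hb.2.1).isUnit) f
  refine ⟨g, ?_, fun w hw => ⟨fun hwD => ?_, m.degree f, m.degree_mem_support hf0, ?_⟩⟩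
  · rw [hfg, add_sub_cancel_right, Finsupp.linearCombination_apply]
    exact Ideal.sum_mem _ fun b _ => I.mul_mem_left _ b.2.1
  · obtain ⟨b, hb, hb0, rfl⟩ := hD hwD
    exact hg _ hw b ⟨hb, hb0, hwD⟩ le_rfl
  · refine (m.le_degree hw).trans ?_
    rw [← sub_eq_of_eq_add' hfg]
    refine m.degree_sub_le.trans (sup_le le_rfl ?_)
    rw [Finsupp.linearCombination_apply]
    refine m.degree_sum_le.trans (Finset.sup_le fun b _ => ?_)
    simpa only [smul_eq_mul, mul_comm] using hdeg b

theorem exists_reduced_of_mem_leadExps {D : Set (σ →₀ ℕ)} (hD : D ⊆ leadExps m I) {w : σ →₀ ℕ}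
    (hw : w ∈ leadExps m I) (hwD : w ∉ D) :
    ∃ g ∈ I, g ≠ 0 ∧ m.degree g = w ∧ ∀ v ∈ g.support, v ∉ D := by
  classical
  obtain ⟨f, hf, hf0, rfl⟩ := hw
  obtain ⟨g, hfg, hg⟩ := exists_reduction hD (f - m.leadingTerm f)
  have hlt : ∀ v ∈ g.support, m.toSyn v < m.toSyn (m.degree f) := by
    intro v hv
    obtain ⟨v', hv', hle⟩ := (hg v hv).2
    refine hle.trans_lt (lt_of_le_of_ne ?_ fun heq => mem_support_iff.1 hv' ?_)
    · exact (m.le_degree hv').trans (m.degree_sub_leadingTerm_le f)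
    · rw [m.toSyn.injective heq, MonomialOrder.leadingTerm, coeff_sub, coeff_monomial, if_pos rfl,
        MonomialOrder.leadingCoeff, sub_self]
  have hmem : m.degree f ∈ (m.leadingTerm f + g).support := by
    rw [mem_support_iff, coeff_add, MonomialOrder.leadingTerm, coeff_monomial, if_pos rfl,
      notMem_support_iff.1 fun h => lt_irrefl _ (hlt _ h), add_zero]
    exact m.leadingCoeff_ne_zero_iff.2 hf0
  have hsupp : ∀ v ∈ (m.leadingTerm f + g).support, v = m.degree f ∨ v ∈ g.support := by
    intro v hv
    rw [← Finset.mem_singleton, ← m.support_leadingTerm' hf0]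
    exact Finset.mem_union.1 (support_add hv)
  refine ⟨m.leadingTerm f + g, ?_, support_nonempty.1 ⟨_, hmem⟩,
    degree_eq_of_forall_le hmem fun v hv => ?_, fun v hv => ?_⟩
  · rw [show m.leadingTerm f + g = f - (f - m.leadingTerm f - g) by ring]
    exact I.sub_mem hf hfg
  · rcases hsupp v hv with rfl | hv
    exacts [le_rfl, (hlt v hv).le]
  · rcases hsupp v hv with rfl | hv
    exacts [hwD, (hg v hv).1]

end LeadExps

/-! ### Separating the variables -/

section Split

variable {σ τ ρ R : Type*} [CommSemiring R]

/-- The exponent vector in the variables `σ = τ ⊔ ρ` with given parts in `τ` and in `ρ`. -/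
def joinExp (e : σ ≃ τ ⊕ ρ) : (τ →₀ ℕ) × (ρ →₀ ℕ) ≃+ (σ →₀ ℕ) :=
  Finsupp.sumFinsuppAddEquivProdFinsupp.symm.trans (Finsupp.domCongr e.symm)

/-- Polynomials in the variables `σ = τ ⊔ ρ` as polynomials in the variables `τ` over the ring of
polynomials in the variables `ρ`. -/
def split (e : σ ≃ τ ⊕ ρ) : MvPolynomial σ R ≃ₐ[R] MvPolynomial τ (MvPolynomial ρ R) :=
  (renameEquiv R e).trans (sumAlgEquiv R τ ρ)

/-- The inclusion of the ring of polynomials in the variables `ρ` into that in the variables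
`σ = τ ⊔ ρ`. -/
def inclRight (e : σ ≃ τ ⊕ ρ) : MvPolynomial ρ R →ₐ[R] MvPolynomial σ R :=
  rename (e.symm ∘ Sum.inr)

variable (e : σ ≃ τ ⊕ ρ)

theorem joinExp_apply_inl (v : τ →₀ ℕ) (t : ρ →₀ ℕ) (i : τ) :
    joinExp e (v, t) (e.symm (Sum.inl i)) = v i := by
  simp [joinExp]

theorem joinExp_apply_inr (v : τ →₀ ℕ) (t : ρ →₀ ℕ) (i : ρ) :
    joinExp e (v, t) (e.symm (Sum.inr i)) = t i := by
  simp [joinExp]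

theorem joinExp_le_joinExp {v v' : τ →₀ ℕ} {t t' : ρ →₀ ℕ} :
    joinExp e (v, t) ≤ joinExp e (v', t') ↔ v ≤ v' ∧ t ≤ t' := by
  simp_rw [Finsupp.le_def, ← e.symm.forall_congr_right, Sum.forall, joinExp_apply_inl,
    joinExp_apply_inr]

theorem joinExp_eq_mapDomain_add_mapDomain (v : τ →₀ ℕ) (t : ρ →₀ ℕ) :
    joinExp e (v, t) = v.mapDomain (e.symm ∘ Sum.inl) + t.mapDomain (e.symm ∘ Sum.inr) := by
  have hinl := e.symm.injective.comp (Sum.inl_injective (β := ρ))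
  have hinr := e.symm.injective.comp (Sum.inr_injective (α := τ))
  ext j
  obtain ⟨j | j, rfl⟩ := e.symm.surjective j
  · rw [joinExp_apply_inl, Finsupp.add_apply, ← Function.comp_apply (f := e.symm) (g := Sum.inl),
      Finsupp.mapDomain_apply hinl, Finsupp.mapDomain_of_notMem_range _ _ (by simp), add_zero]
  · rw [joinExp_apply_inr, Finsupp.add_apply, ← Function.comp_apply (f := e.symm) (g := Sum.inr),
      Finsupp.mapDomain_apply hinr, Finsupp.mapDomain_of_notMem_range _ _ (by simp), zero_add]

theorem joinExp_single_left (i : τ) (N : ℕ) :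
    joinExp e (Finsupp.single i N, 0) = Finsupp.single (e.symm (Sum.inl i)) N := by
  simp [joinExp_eq_mapDomain_add_mapDomain]

theorem joinExp_single_right (i : ρ) (N : ℕ) :
    joinExp e (0, Finsupp.single i N) = Finsupp.single (e.symm (Sum.inr i)) N := by
  simp [joinExp_eq_mapDomain_add_mapDomain]

theorem joinExp_eq_add (v : τ →₀ ℕ) (t : ρ →₀ ℕ) :
    joinExp e (v, t) = joinExp e (v, 0) + joinExp e (0, t) := by
  rw [← map_add, Prod.mk_add_mk, add_zero, zero_add]

theorem degree_joinExp (v : τ →₀ ℕ) (t : ρ →₀ ℕ) :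
    (joinExp e (v, t)).degree = v.degree + t.degree := by
  simp [joinExp_eq_mapDomain_add_mapDomain, Finsupp.degree_mapDomain]

theorem split_monomial (v : τ →₀ ℕ) (t : ρ →₀ ℕ) (a : R) :
    split e (monomial (joinExp e (v, t)) a) = monomial v (monomial t a) := by
  have : (joinExp e (v, t)).mapDomain e = Finsupp.sumFinsuppAddEquivProdFinsupp.symm (v, t) := by
    simp [joinExp, Finsupp.equivMapDomain_eq_mapDomain, ← Finsupp.mapDomain_comp]
  rw [split, AlgEquiv.trans_apply, renameEquiv_apply, rename_monomial, this]
  simp [sumAlgEquiv, monomial]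

theorem coeff_coeff_split (f : MvPolynomial σ R) (v : τ →₀ ℕ) (t : ρ →₀ ℕ) :
    coeff t (coeff v (split e f)) = coeff (joinExp e (v, t)) f := by
  classical
  induction f using MvPolynomial.induction_on' with
  | monomial w a =>
    obtain ⟨⟨v', t'⟩, rfl⟩ := (joinExp e).surjective w
    rw [split_monomial]
    simp only [coeff_monomial, (joinExp e).injective.eq_iff, Prod.mk.injEq, apply_ite (coeff t),
      coeff_zero, ite_and]
  | add p q hp hq => simp only [map_add, coeff_add, hp, hq]

theorem inclRight_monomial (t : ρ →₀ ℕ) (a : R) :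
    inclRight e (monomial t a) = monomial (joinExp e (0, t)) a := by
  simp [inclRight, rename_monomial, joinExp_eq_mapDomain_add_mapDomain]

theorem split_inclRight (g : MvPolynomial ρ R) : split e (inclRight e g) = C g := by
  induction g using MvPolynomial.induction_on' with
  | monomial t a => rw [inclRight_monomial, split_monomial]; rfl
  | add p q hp hq => simp only [map_add, hp, hq]

end Split

/-! ### Dimension -/

section Dimension

theorem ringKrullDim_eq_iff_injective_of_isIntegral {A B : Type*} [CommRing A] [IsDomain A]
    [FiniteRingKrullDim A] [CommRing B] {φ : A →+* B} (hφ : φ.IsIntegral) :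
    ringKrullDim B = ringKrullDim A ↔ Function.Injective φ := by
  have hquot : ringKrullDim B = ringKrullDim (A ⧸ RingHom.ker φ) := by
    let := φ.kerLift.toAlgebra
    have : Algebra.IsIntegral (A ⧸ RingHom.ker φ) B := ⟨fun b => by
      obtain ⟨p, hp, hb⟩ := hφ b
      refine ⟨p.map (Ideal.Quotient.mk _), hp.map _, ?_⟩
      rwa [Polynomial.eval₂_map]⟩
    exact ringKrullDim_eq_of_isIntegral_of_injective φ.kerLift_injective
  refine ⟨fun h => ?_, fun h => ?_⟩
  · rw [injective_iff_map_eq_zero]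
    by_contra! hker
    obtain ⟨a, ha, ha0⟩ := hker
    have hle := ringKrullDim_le_of_surjective _ <| Ideal.Quotient.factor_surjective
      ((Ideal.span_singleton_le_iff_mem (RingHom.ker φ)).2 ha)
    have hlt := ringKrullDim_quotient_succ_le_of_nonZeroDivisor (mem_nonZeroDivisors_of_ne_zero ha0)
    have : ringKrullDim A + 1 ≤ ringKrullDim A := by
      refine le_trans ?_ hlt
      gcongr
      rwa [← h, hquot]
    obtain ⟨d, hd⟩ := WithBot.ne_bot_iff_exists.1 (ringKrullDim_ne_bot (R := A))
    have hfin := ringKrullDim_ne_top (R := A)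
    rw [← hd] at this hfin
    norm_cast at this
    exact ((ENat.lt_add_one_iff (by rintro rfl; exact hfin rfl)).2 le_rfl).not_ge this
  · let := φ.toAlgebra
    have : Algebra.IsIntegral A B := ⟨hφ⟩
    exact ringKrullDim_eq_of_isIntegral_of_injective h

variable {σ τ ρ k : Type*} [Field k] {m : MonomialOrder σ} {I : Ideal (MvPolynomial σ k)}

theorem monomial_joinExp (e : σ ≃ τ ⊕ ρ) (v : τ →₀ ℕ) (t : ρ →₀ ℕ) (a : k) :
    monomial (joinExp e (v, t)) a =
      inclRight e (monomial t a) * monomial (joinExp e (v, 0)) 1 := by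
  rw [inclRight_monomial, monomial_mul, mul_one, add_comm, ← joinExp_eq_add]

theorem coeff_joinExp_zero_inclRight (e : σ ≃ τ ⊕ ρ) (t : ρ →₀ ℕ) (g : MvPolynomial ρ k) :
    coeff (joinExp e (0, t)) (inclRight e g) = coeff t g := by
  rw [← coeff_coeff_split, split_inclRight, coeff_zero_C]

theorem mem_support_inclRight (e : σ ≃ τ ⊕ ρ) {w : σ →₀ ℕ} {g : MvPolynomial ρ k} :
    w ∈ (inclRight e g).support ↔ ∃ t ∈ g.support, joinExp e (0, t) = w := by
  classical
  constructor
  · obtain ⟨⟨v, t⟩, rfl⟩ := (joinExp e).surjective w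
    rw [mem_support_iff, ← coeff_coeff_split, split_inclRight, coeff_C]
    split_ifs with hv
    · exact fun ht => ⟨t, mem_support_iff.2 ht, by rw [hv]⟩
    · exact fun h => absurd rfl h
  · rintro ⟨t, ht, rfl⟩
    rwa [mem_support_iff, coeff_joinExp_zero_inclRight, ← mem_support_iff]

/-- The exponents of the monomials in the variables `τ` alone that belong to `E`. -/
def sectionExps (e : σ ≃ τ ⊕ ρ) (E : Set (σ →₀ ℕ)) : Set (τ →₀ ℕ) :=
  {v | joinExp e (v, 0) ∈ E}

/-- The exponents of the monomials obtained from those in `E` by setting the variables `ρ` to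
`1`. -/
def projExps (e : σ ≃ τ ⊕ ρ) (E : Set (σ →₀ ℕ)) : Set (τ →₀ ℕ) :=
  {v | ∃ t, joinExp e (v, t) ∈ E}

/-- The exponents whose part in the variables `τ` belongs to `V`. -/
def cylinder (e : σ ≃ τ ⊕ ρ) (V : Set (τ →₀ ℕ)) : Set (σ →₀ ℕ) :=
  {w | ((joinExp e).symm w).1 ∈ V}

theorem joinExp_mem_cylinder {e : σ ≃ τ ⊕ ρ} {V : Set (τ →₀ ℕ)} {v : τ →₀ ℕ} {t : ρ →₀ ℕ} :
    joinExp e (v, t) ∈ cylinder e V ↔ v ∈ V := by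
  rw [cylinder, Set.mem_ofPred_eq, AddEquiv.symm_apply_apply]

theorem cylinder_sectionExps_subset {e : σ ≃ τ ⊕ ρ} {E : Set (σ →₀ ℕ)} (hE : IsUpperSet E) :
    cylinder e (sectionExps e E) ⊆ E := by
  intro w hw
  obtain ⟨⟨v, t⟩, rfl⟩ := (joinExp e).surjective w
  rw [joinExp_mem_cylinder] at hw
  exact hE ((joinExp_le_joinExp e).2 ⟨le_rfl, zero_le⟩) hw

theorem isUpperSet_sectionExps {e : σ ≃ τ ⊕ ρ} {E : Set (σ →₀ ℕ)} (hE : IsUpperSet E) :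
    IsUpperSet (sectionExps e E) :=
  fun _ _ hle hv => hE ((joinExp_le_joinExp e).2 ⟨hle, le_rfl⟩) hv

theorem finite_compl_of_isUpperSet [Finite σ] {E : Set (σ →₀ ℕ)} (hE : IsUpperSet E)
    (h : ∀ i, ∃ N, Finsupp.single i N ∈ E) : Eᶜ.Finite := by
  classical
  have := Fintype.ofFinite σ
  choose N hN using h
  refine (Set.finite_Iic (Finsupp.equivFunOnFinite.symm N)).subset fun v hv i => ?_
  by_contra! hlt
  exact hv (hE (Finsupp.single_le_iff.2 hlt.le) (hN i))

theorem sectionExps_compl_finite [Finite τ] (e : σ ≃ τ ⊕ ρ) {E : Set (σ →₀ ℕ)} (hE : IsUpperSet E)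
    (h : ∀ i : τ, ∃ N, Finsupp.single (e.symm (Sum.inl i)) N ∈ E) : (sectionExps e E)ᶜ.Finite := by
  simp_rw [← joinExp_single_left] at h
  exact finite_compl_of_isUpperSet (isUpperSet_sectionExps hE) h

theorem finite_mk_comp_inclRight [Finite τ] (e : σ ≃ τ ⊕ ρ)
    (h : ∀ i : τ, ∃ N, Finsupp.single (e.symm (Sum.inl i)) N ∈ leadExps m I) :
    ((Ideal.Quotient.mk I).comp (inclRight (R := k) e).toRingHom).Finite := by
  let φ : MvPolynomial ρ k →+* MvPolynomial σ k ⧸ I :=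
    (Ideal.Quotient.mk I).comp (inclRight (R := k) e).toRingHom
  let : Algebra (MvPolynomial ρ k) (MvPolynomial σ k ⧸ I) := φ.toAlgebra
  let : Module (MvPolynomial ρ k) (MvPolynomial σ k ⧸ I) := Algebra.toModule
  refine ⟨Submodule.fg_def.2 ⟨(fun v => Ideal.Quotient.mk I (monomial (joinExp e (v, 0)) 1)) ''
    (sectionExps e (leadExps m I))ᶜ,
    (sectionExps_compl_finite e (isUpperSet_leadExps m I) h).image _, ?_⟩⟩
  refine eq_top_iff.2 (Ideal.Quotient.mk_surjective.forall.2 fun f _ => ?_)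
  obtain ⟨g, hfg, hg⟩ :=
    exists_reduction (cylinder_sectionExps_subset (e := e) (isUpperSet_leadExps m I)) f
  rw [Ideal.Quotient.mk_eq_mk_iff_sub_mem _ _ |>.2 hfg, g.as_sum, map_sum]
  refine Submodule.sum_mem _ fun w hw => ?_
  obtain ⟨⟨v, t⟩, rfl⟩ := (joinExp e).surjective w
  rw [monomial_joinExp, map_mul]
  refine Submodule.smul_mem _ (monomial t _) (Submodule.subset_span ⟨v, ?_, rfl⟩)
  exact fun hv => (hg _ hw).1 (joinExp_mem_cylinder.2 hv)

theorem ringKrullDim_quotient_eq_iff [Finite τ] [Finite ρ] (e : σ ≃ τ ⊕ ρ)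
    (h : ∀ i : τ, ∃ N, Finsupp.single (e.symm (Sum.inl i)) N ∈ leadExps m I) :
    ringKrullDim (MvPolynomial σ k ⧸ I) = Nat.card ρ ↔
      ∀ g : MvPolynomial ρ k, inclRight e g ∈ I → g = 0 := by
  have hdim : ringKrullDim (MvPolynomial ρ k) = Nat.card ρ := by
    rw [MvPolynomial.ringKrullDim_of_isNoetherianRing, ringKrullDim_eq_zero_of_field, zero_add]
  have : FiniteRingKrullDim (MvPolynomial ρ k) :=
    finiteRingKrullDim_iff_ne_bot_and_top.2 (by rw [hdim]; exact ⟨nofun, nofun⟩)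
  rw [← hdim,
    ringKrullDim_eq_iff_injective_of_isIntegral (finite_mk_comp_inclRight e h).to_isIntegral,
    injective_iff_map_eq_zero]
  exact forall_congr' fun g => by rw [← Ideal.Quotient.eq_zero_iff_mem]; rfl

end Dimension

/-! ### Multiplicities of monomial ideals -/

section MonomialIdeals

variable {k : Type*} [Field k]

theorem mem_restrictSupportIdeal {σ : Type*} {E : Set (σ →₀ ℕ)} (hE : IsUpperSet E)
    {f : MvPolynomial σ k} : f ∈ restrictSupportIdeal k E hE ↔ ∀ w ∈ f.support, w ∈ E :=
  Iff.rfl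

theorem restrictSupportIdeal_eq_span {σ : Type*} {E : Set (σ →₀ ℕ)} (hE : IsUpperSet E) :
    restrictSupportIdeal k E hE = Ideal.span ((fun w => monomial w 1) '' E) := by
  refine le_antisymm (fun f hf => mem_ideal_span_monomial_image.2 fun w hw => ⟨w, hf hw, le_rfl⟩)
    (Ideal.span_le.2 ?_)
  rintro _ ⟨w, hw, rfl⟩
  exact (monomial_mem_restrictSupport k).2 (Or.inl hw)

theorem monomial_mem_restrictSupportIdeal {σ : Type*} {E : Set (σ →₀ ℕ)} (hE : IsUpperSet E)
    {w : σ →₀ ℕ} : monomial w 1 ∈ restrictSupportIdeal k E hE ↔ w ∈ E :=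
  (monomial_mem_restrictSupport k).trans (or_iff_left one_ne_zero)

theorem leadExps_restrictSupportIdeal {σ : Type*} {m : MonomialOrder σ} {E : Set (σ →₀ ℕ)}
    (hE : IsUpperSet E) : leadExps m (restrictSupportIdeal k E hE) = E := by
  classical
  refine Set.Subset.antisymm ?_ fun w hw => ?_
  · rintro _ ⟨f, hf, hf0, rfl⟩
    exact hf (m.degree_mem_support hf0)
  · exact ⟨monomial w 1, (monomial_mem_restrictSupportIdeal hE).2 hw, by simp,
      by rw [MonomialOrder.degree_monomial, if_neg one_ne_zero]⟩

variable {n : ℕ} {E : Set (Fin n →₀ ℕ)} (hE : IsUpperSet E)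

theorem hilbertFunction_restrictSupportIdeal (m : ℕ) :
    hilbertFunction (restrictSupportIdeal k E hE) m =
      Nat.card {w : Fin n →₀ ℕ // w.degree = m ∧ w ∉ E} := by
  let q := (Ideal.Quotient.mkₐ k (restrictSupportIdeal k E hE)).toLinearMap
  have hker : ∀ f, q f = 0 ↔ ↑f.support ⊆ E := fun f => Ideal.Quotient.eq_zero_iff_mem
  let D : Set (Fin n →₀ ℕ) := {w | w.degree = m}
  have hhom : homogeneousSubmodule (Fin n) k m =
      restrictSupport k (D \ E) ⊔ restrictSupport k (D ∩ E) := by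
    rw [restrictSupport_eq_span, restrictSupport_eq_span, ← Submodule.span_union, ← Set.image_union,
      Set.sdiff_union_inter, ← restrictSupport_eq_span]
    exact homogeneousSubmodule_eq_finsupp_supported (Fin n) k m
  have hmap : (homogeneousSubmodule (Fin n) k m).map q =
      LinearMap.range (q.domRestrict (restrictSupport k (D \ E))) := by
    rw [hhom, Submodule.map_sup, LinearMap.range_domRestrict, sup_eq_left]
    rintro _ ⟨f, hf, rfl⟩
    rw [(hker f).2 fun w hw => (hf hw).2]
    exact Submodule.zero_mem _
  have hinj : Function.Injective (q.domRestrict (restrictSupport k (D \ E))) := by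
    rw [injective_iff_map_eq_zero]
    rintro ⟨f, hf⟩ h0
    refine Subtype.ext (support_eq_empty.1 (Finset.eq_empty_of_forall_notMem fun w hw => ?_))
    exact (hf hw).2 ((hker f).1 h0 hw)
  rw [hilbertFunction, hmap, LinearMap.finrank_range_of_inj hinj,
    Module.finrank_eq_nat_card_basis (basisRestrictSupport k _)]
  rfl

theorem mk_card_degree_mul_one_sub_X_pow (τ : Type*) [Finite τ] :
    (PowerSeries.mk fun m => (Nat.card {t : τ →₀ ℕ // t.degree = m} : ℤ)) *
      (1 - PowerSeries.X) ^ Nat.card τ = 1 := by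
  classical
  have := Fintype.ofFinite τ
  have hcard (m : ℕ) : Nat.card {t : τ →₀ ℕ // t.degree = m} = (Nat.card τ).multichoose m := by
    rw [Nat.card_eq_fintype_card (α := τ), ← Sym.card_sym_eq_multichoose,
      ← Nat.card_eq_fintype_card]
    exact (Nat.card_congr (Sym.equivNatSum τ m)).symm
  simp only [hcard]
  generalize Nat.card τ = d
  suffices h : (PowerSeries.mk fun m => (d.multichoose m : ℤ)) =
      (PowerSeries.invOneSubPow ℤ d).val by
    rw [h, ← PowerSeries.invOneSubPow_inv_eq_one_sub_pow]
    exact (PowerSeries.invOneSubPow ℤ d).val_inv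
  ext m
  cases d with
  | zero => cases m <;> simp [PowerSeries.invOneSubPow_zero, PowerSeries.coeff_one]
  | succ d =>
    rw [PowerSeries.invOneSubPow_val_succ_eq_mk_add_choose, PowerSeries.coeff_mk,
      PowerSeries.coeff_mk, Nat.multichoose_eq, show d + 1 + m - 1 = d + m by omega,
      Nat.choose_symm_add]

variable {τ ρ : Type*} {e : Fin n ≃ τ ⊕ ρ} {B : Finset (τ →₀ ℕ)}

theorem card_degree_eq_and_notMem [Finite ρ] (hB : ∀ v t, joinExp e (v, t) ∉ E ↔ v ∈ B) (m : ℕ) :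
    Nat.card {w : Fin n →₀ ℕ // w.degree = m ∧ w ∉ E} =
      ∑ v ∈ B, Nat.card {t : ρ →₀ ℕ // v.degree + t.degree = m} := by
  have (v : B) : Finite {t : ρ →₀ ℕ // v.1.degree + t.degree = m} :=
    (Finsupp.finite_of_degree_le m).subset fun t (ht : _ = _) => le_add_self.trans_eq ht
  rw [← Finset.sum_coe_sort B, ← Nat.card_sigma]
  let φ : (Σ v : B, {t : ρ →₀ ℕ // v.1.degree + t.degree = m}) →
      {w : Fin n →₀ ℕ // w.degree = m ∧ w ∉ E} := fun x =>
    ⟨joinExp e (x.1, x.2), by rw [degree_joinExp, x.2.2], (hB _ _).2 x.1.2⟩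
  refine (Nat.card_congr (Equiv.ofBijective φ ⟨?_, ?_⟩)).symm
  · rintro ⟨⟨v, hv⟩, t, ht⟩ ⟨⟨v', hv'⟩, t', ht'⟩ h
    have := (joinExp e).injective (congrArg Subtype.val h)
    cases this
    rfl
  · rintro ⟨w, hw, hwE⟩
    obtain ⟨⟨v, t⟩, rfl⟩ := (joinExp e).surjective w
    exact ⟨⟨⟨v, (hB v t).1 hwE⟩, t, by rwa [degree_joinExp] at hw⟩, rfl⟩

theorem hilbertSeries_restrictSupportIdeal [Finite ρ]
    (hB : ∀ v t, joinExp e (v, t) ∉ E ↔ v ∈ B) :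
    hilbertSeries (restrictSupportIdeal k E hE) = (∑ v ∈ B, PowerSeries.X ^ v.degree) *
      PowerSeries.mk fun m => (Nat.card {t : ρ →₀ ℕ // t.degree = m} : ℤ) := by
  ext m
  rw [hilbertSeries, PowerSeries.coeff_mk, hilbertFunction_restrictSupportIdeal,
    card_degree_eq_and_notMem hB, Finset.sum_mul, map_sum, Nat.cast_sum]
  refine Finset.sum_congr rfl fun v _ => ?_
  rw [PowerSeries.coeff_X_pow_mul']
  split_ifs with hvm
  · rw [PowerSeries.coeff_mk]
    exact congrArg _ (Nat.card_congr (Equiv.subtypeEquivRight fun t => by omega))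
  · rw [Nat.cast_eq_zero, Nat.card_eq_zero]
    exact Or.inl ⟨fun t => hvm (le_self_add.trans_eq t.2)⟩

theorem dimQuot_restrictSupportIdeal [Finite τ] [Finite ρ]
    (hB : ∀ v t, joinExp e (v, t) ∉ E ↔ v ∈ B) (hne : B.Nonempty) :
    dimQuot (restrictSupportIdeal k E hE) = Nat.card ρ := by
  obtain ⟨u, hu⟩ := hne
  suffices h : ringKrullDim (MvPolynomial (Fin n) k ⧸ restrictSupportIdeal k E hE) = Nat.card ρ by
    rw [dimQuot, h]
    rfl
  refine (ringKrullDim_quotient_eq_iff (m := degRevLex n) e fun i => ?_).2 fun g hg => ?_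
  · rw [leadExps_restrictSupportIdeal]
    by_contra! h
    refine Set.infinite_range_of_injective (Finsupp.single_injective i)
      (B.finite_toSet.subset (Set.range_subset_iff.2 fun N => (hB _ 0).1 ?_))
    rw [joinExp_single_left]
    exact h N
  · by_contra h0
    obtain ⟨t, ht⟩ := ne_zero_iff.1 h0
    have hmem : joinExp e (0, t) ∈ E := (mem_restrictSupportIdeal hE).1 hg _
      (mem_support_iff.2 (by rwa [coeff_joinExp_zero_inclRight]))
    exact (hB u t).2 hu (hE ((joinExp_le_joinExp e).2 ⟨zero_le, le_rfl⟩) hmem)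

theorem deg_restrictSupportIdeal [Finite τ] [Finite ρ]
    (hB : ∀ v t, joinExp e (v, t) ∉ E ↔ v ∈ B) :
    deg (restrictSupportIdeal k E hE) = B.card := by
  set I := restrictSupportIdeal k E hE
  have hseries : ((∑ v ∈ B, Polynomial.X ^ v.degree : Polynomial ℤ) : PowerSeries ℤ) =
      hilbertSeries I * (1 - PowerSeries.X) ^ dimQuot I := by
    rw [hilbertSeries_restrictSupportIdeal hE hB]
    rcases B.eq_empty_or_nonempty with rfl | hne
    · simp
    rw [dimQuot_restrictSupportIdeal hE hB hne, mul_assoc, mk_card_degree_mul_one_sub_X_pow,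
      mul_one, ← Polynomial.coeToPowerSeries.ringHom_apply, map_sum]
    simp
  have hex : ∃ q : Polynomial ℤ,
      (q : PowerSeries ℤ) = hilbertSeries I * (1 - PowerSeries.X) ^ dimQuot I := ⟨_, hseries⟩
  rw [deg, hilbertNumerator, dif_pos hex,
    Polynomial.coe_injective ℤ (hex.choose_spec.trans hseries.symm)]
  simp [Polynomial.eval_finsetSum]

end MonomialIdeals

section PhiPi

variable {σ τ ρ : Type*} {e : σ ≃ τ ⊕ ρ} {E : Set (σ →₀ ℕ)}

theorem sectionExps_subset_projExps : sectionExps e E ⊆ projExps e E :=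
  fun _ hv => ⟨0, hv⟩

theorem isUpperSet_projExps (hE : IsUpperSet E) : IsUpperSet (projExps e E) :=
  fun _ _ hle ⟨t, ht⟩ => ⟨t, hE ((joinExp_le_joinExp e).2 ⟨hle, le_rfl⟩) ht⟩

theorem isUpperSet_cylinder {V : Set (τ →₀ ℕ)} (hV : IsUpperSet V) : IsUpperSet (cylinder e V) := by
  intro w w' hle hw
  obtain ⟨⟨v, t⟩, rfl⟩ := (joinExp e).surjective w
  obtain ⟨⟨v', t'⟩, rfl⟩ := (joinExp e).surjective w'
  rw [joinExp_mem_cylinder] at hw ⊢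
  exact hV ((joinExp_le_joinExp e).1 hle).1 hw

variable {k : Type*} [Field k] {c d : ℕ}

theorem filter_joinExp (v : Fin c →₀ ℕ) (t : Fin d →₀ ℕ) :
    (joinExp finSumFinEquiv.symm (v, t)).filter (fun i : Fin (c + d) => (i : ℕ) < c) =
      joinExp finSumFinEquiv.symm (v, 0) := by
  ext i
  obtain ⟨i | i, rfl⟩ := finSumFinEquiv.surjective i
  · rw [Finsupp.filter_apply_pos _ _ (by simp)]
    exact (joinExp_apply_inl _ v t i).trans (joinExp_apply_inl _ v 0 i).symm
  · rw [Finsupp.filter_apply_neg _ _ (by simp)]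
    exact (joinExp_apply_inr _ v 0 i).symm

theorem Phi_restrictSupportIdeal {E : Set (Fin (c + d) →₀ ℕ)} (hE : IsUpperSet E) :
    Phi c (restrictSupportIdeal k E hE) =
      restrictSupportIdeal k (cylinder finSumFinEquiv.symm (projExps finSumFinEquiv.symm E))
        (isUpperSet_cylinder (isUpperSet_projExps hE)) := by
  refine le_antisymm (Ideal.span_le.2 ?_) ?_
  · rintro _ ⟨u, hu, rfl⟩
    obtain ⟨⟨v, t⟩, rfl⟩ := (joinExp finSumFinEquiv.symm).surjective u
    rw [filter_joinExp, SetLike.mem_coe, monomial_mem_restrictSupportIdeal, joinExp_mem_cylinder]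
    exact ⟨t, (monomial_mem_restrictSupportIdeal hE).1 hu.1⟩
  · rw [restrictSupportIdeal_eq_span, Ideal.span_le]
    rintro _ ⟨w, hw, rfl⟩
    obtain ⟨⟨v, t⟩, rfl⟩ := (joinExp finSumFinEquiv.symm).surjective w
    obtain ⟨t', ht'⟩ := joinExp_mem_cylinder.1 hw
    obtain ⟨u, hu, hmin⟩ := exists_minimal_le_of_wellFoundedLT
      (fun w => monomial w 1 ∈ restrictSupportIdeal k E hE) _
      ((monomial_mem_restrictSupportIdeal hE).2 ht')
    obtain ⟨⟨v', t''⟩, rfl⟩ := (joinExp finSumFinEquiv.symm).surjective u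
    refine Ideal.mem_of_dvd _ (monomial_dvd_monomial.2 ⟨Or.inr ?_, one_dvd 1⟩)
      (Ideal.subset_span ⟨_, hmin, by rw [filter_joinExp]⟩)
    exact (joinExp_le_joinExp _).2 ⟨((joinExp_le_joinExp _).1 hu).1, zero_le⟩

theorem deg_Phi_restrictSupportIdeal {E : Set (Fin (c + d) →₀ ℕ)} (hE : IsUpperSet E)
    (hfin : (projExps finSumFinEquiv.symm E : Set (Fin c →₀ ℕ))ᶜ.Finite) :
    deg (Phi c (restrictSupportIdeal k E hE)) =
      (projExps finSumFinEquiv.symm E : Set (Fin c →₀ ℕ))ᶜ.ncard := by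
  rw [Phi_restrictSupportIdeal, deg_restrictSupportIdeal (e := finSumFinEquiv.symm)
    (B := hfin.toFinset), Set.ncard_eq_toFinset_card _ hfin]
  intro v t
  rw [joinExp_mem_cylinder, hfin.mem_toFinset, Set.mem_compl_iff]

theorem coeff_piHom (f : MvPolynomial (Fin (c + d)) k) (v : Fin c →₀ ℕ) :
    coeff v (piHom k (c + d) c f) = coeff (joinExp finSumFinEquiv.symm (v, 0)) f := by
  have : piHom k (c + d) c = (mapAlgHom (aeval 0)).comp (split finSumFinEquiv.symm).toAlgHom := by
    ext i : 1
    obtain ⟨i | i, rfl⟩ := finSumFinEquiv.surjective i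
    · simp [piHom, split]
    · simp [piHom, split]
  rw [this, ← coeff_coeff_split]
  simpa [← constantCoeff_eq] using coeff_map constantCoeff (split finSumFinEquiv.symm f) v

theorem map_piHom_restrictSupportIdeal {E : Set (Fin (c + d) →₀ ℕ)} (hE : IsUpperSet E) :
    (restrictSupportIdeal k E hE).map (piHom k (c + d) c) =
      restrictSupportIdeal k (sectionExps finSumFinEquiv.symm E) (isUpperSet_sectionExps hE) := by
  refine le_antisymm (Ideal.map_le_iff_le_comap.2 fun f hf v hv => ?_) ?_
  · refine (mem_restrictSupportIdeal hE).1 hf (joinExp finSumFinEquiv.symm (v, 0)) ?_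
    rwa [mem_support_iff, ← coeff_piHom, ← mem_support_iff]
  · rw [restrictSupportIdeal_eq_span, Ideal.span_le]
    rintro _ ⟨v, hv, rfl⟩
    have hmon : piHom k (c + d) c (monomial (joinExp finSumFinEquiv.symm (v, 0)) 1) =
        monomial v 1 := by
      classical
      ext v'
      simp [coeff_piHom, coeff_monomial]
    change monomial v 1 ∈ _
    rw [← hmon]
    exact Ideal.mem_map_of_mem _ ((monomial_mem_restrictSupportIdeal hE).2 hv)

theorem deg_map_piHom_restrictSupportIdeal {E : Set (Fin (c + d) →₀ ℕ)} (hE : IsUpperSet E)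
    (hfin : (sectionExps finSumFinEquiv.symm E : Set (Fin c →₀ ℕ))ᶜ.Finite) :
    deg ((restrictSupportIdeal k E hE).map (piHom k (c + d) c)) =
      (sectionExps finSumFinEquiv.symm E : Set (Fin c →₀ ℕ))ᶜ.ncard := by
  rw [map_piHom_restrictSupportIdeal, deg_restrictSupportIdeal (e := (Equiv.sumEmpty _ Empty).symm)
    (B := hfin.toFinset), Set.ncard_eq_toFinset_card _ hfin]
  intro v t
  have : joinExp (Equiv.sumEmpty (Fin c) Empty).symm (v, t) = v :=
    Finsupp.ext fun i => joinExp_apply_inl _ v t i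
  rw [this, hfin.mem_toFinset, Set.mem_compl_iff]

theorem exists_projExps_diff_sectionExps_eq_singleton {E : Set (Fin (c + d) →₀ ℕ)}
    (hE : IsUpperSet E) (hfin : (sectionExps finSumFinEquiv.symm E : Set (Fin c →₀ ℕ))ᶜ.Finite)
    (hdeg : deg (Phi c (restrictSupportIdeal k E hE)) + 1 =
      deg ((restrictSupportIdeal k E hE).map (piHom k (c + d) c))) :
    ∃ u : Fin c →₀ ℕ, projExps finSumFinEquiv.symm E \ sectionExps finSumFinEquiv.symm E = {u} := by
  have hsub : (projExps finSumFinEquiv.symm E : Set (Fin c →₀ ℕ))ᶜ ⊆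
      (sectionExps finSumFinEquiv.symm E)ᶜ := Set.compl_subset_compl.2 sectionExps_subset_projExps
  rw [deg_Phi_restrictSupportIdeal hE (hfin.subset hsub),
    deg_map_piHom_restrictSupportIdeal hE hfin] at hdeg
  rw [← Set.ncard_eq_one, ← compl_sdiff_compl, Set.ncard_sdiff' hsub hfin]
  omega

end PhiPi

/-! ### Linear changes of coordinates -/

section CoordChange

variable {k : Type*} [Field k] {n : ℕ}

theorem coordChange_X (α : GL (Fin n) k) (j : Fin n) :
    coordChange α (X j) = ∑ i, C (α.val i j) * X i := by
  simp [coordChange]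

theorem coordChange_one : coordChange (1 : GL (Fin n) k) = AlgHom.id k _ := by
  ext j : 1
  rw [coordChange_X, Finset.sum_eq_single j]
  · simp
  · intro i _ hij
    simp [Matrix.one_apply_ne hij]
  · simp

theorem coordChange_mul (α β : GL (Fin n) k) :
    coordChange (α * β) = (coordChange α).comp (coordChange β) := by
  ext j : 1
  simp only [AlgHom.comp_apply, coordChange_X, map_sum, map_mul, algHom_C, Units.val_mul,
    Matrix.mul_apply, Finset.mul_sum, Finset.sum_mul, algebraMap_eq]
  rw [Finset.sum_comm]
  exact Finset.sum_congr rfl fun i _ => Finset.sum_congr rfl fun l _ => by ring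

/-- The linear change of coordinates `coordChange α` as an automorphism of the polynomial ring. -/
def coordEquiv (α : GL (Fin n) k) : MvPolynomial (Fin n) k ≃ₐ[k] MvPolynomial (Fin n) k :=
  AlgEquiv.ofAlgHom (coordChange α) (coordChange α⁻¹)
    (by rw [← coordChange_mul, mul_inv_cancel, coordChange_one])
    (by rw [← coordChange_mul, inv_mul_cancel, coordChange_one])

theorem map_coordChange_mul (I : Ideal (MvPolynomial (Fin n) k)) (α β : GL (Fin n) k) :
    I.map (coordChange (α * β)) = (I.map (coordChange β)).map (coordChange α) := by
  rw [Ideal.map_mapₐ, coordChange_mul]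

theorem map_coordChange_inv (I : Ideal (MvPolynomial (Fin n) k)) (α : GL (Fin n) k) :
    (I.map (coordChange α)).map (coordChange α⁻¹) = I := by
  rw [← map_coordChange_mul, inv_mul_cancel, coordChange_one]
  exact Ideal.map_id I

theorem coordChange_mem_map_iff {I : Ideal (MvPolynomial (Fin n) k)} {α : GL (Fin n) k}
    {f : MvPolynomial (Fin n) k} : coordChange α f ∈ I.map (coordChange α) ↔ f ∈ I :=
  Ideal.apply_mem_of_equiv_iff (f := (coordEquiv α).toRingEquiv)

theorem ringKrullDim_quotient_map_coordChange (I : Ideal (MvPolynomial (Fin n) k))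
    (α : GL (Fin n) k) :
    ringKrullDim (MvPolynomial (Fin n) k ⧸ I.map (coordChange α)) =
      ringKrullDim (MvPolynomial (Fin n) k ⧸ I) :=
  (ringKrullDim_eq_of_ringEquiv
    (Ideal.quotientEquiv I _ (coordEquiv α).toRingEquiv rfl)).symm

theorem coordChange_isHomogeneous (α : GL (Fin n) k) {f : MvPolynomial (Fin n) k} {l : ℕ}
    (hf : f.IsHomogeneous l) : (coordChange α f).IsHomogeneous l := by
  simpa only [one_mul, coordChange] using hf.aeval (n := 1) (fun j => ∑ i, C (α.val i j) * X i)
    fun j => IsHomogeneous.sum _ _ _ fun i _ => isHomogeneous_C_mul_X _ _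

theorem coordChange_homogeneousComponent (α : GL (Fin n) k) (l : ℕ) (f : MvPolynomial (Fin n) k) :
    coordChange α (homogeneousComponent l f) = homogeneousComponent l (coordChange α f) := by
  conv_rhs => rw [← sum_homogeneousComponent f, map_sum, map_sum]
  rw [Finset.sum_congr rfl fun i _ => homogeneousComponent_of_mem
    (coordChange_isHomogeneous α (homogeneousComponent_isHomogeneous i f)), Finset.sum_ite_eq]
  split_ifs with h
  · rfl
  · rw [homogeneousComponent_eq_zero, map_zero]
    simpa using h

theorem coordChange_mem_idealOfVars_iff (α : GL (Fin n) k) (f : MvPolynomial (Fin n) k) :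
    coordChange α f ∈ idealOfVars (Fin n) k ↔ f ∈ idealOfVars (Fin n) k := by
  have h := coordChange_homogeneousComponent α 0 f
  rw [homogeneousComponent_zero, homogeneousComponent_zero, algHom_C, algebraMap_eq] at h
  rw [mem_idealOfVars_iff, mem_idealOfVars_iff, ← C_injective _ _ h]

theorem totalDegree_coordChange_le (α : GL (Fin n) k) (f : MvPolynomial (Fin n) k) :
    (coordChange α f).totalDegree ≤ f.totalDegree := by
  conv_lhs => rw [← sum_homogeneousComponent f, map_sum]
  refine totalDegree_finsetSum_le fun l hl => ?_
  exact (coordChange_isHomogeneous α (homogeneousComponent_isHomogeneous l f)).totalDegree_le.trans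
    (Nat.le_of_lt_succ (Finset.mem_range.1 hl))

theorem IsHomogeneousIdeal.map_coordChange {I : Ideal (MvPolynomial (Fin n) k)}
    (hI : IsHomogeneousIdeal I) (α : GL (Fin n) k) :
    IsHomogeneousIdeal (I.map (coordChange α)) := by
  intro l f hf
  obtain ⟨g, rfl⟩ := (coordEquiv α).surjective f
  change (decomposition.decompose' (coordChange α g) l : MvPolynomial (Fin n) k) ∈ _
  rw [decomposition.decompose'_apply, ← coordChange_homogeneousComponent, coordChange_mem_map_iff]
  exact homogeneousComponent_mem_of_mem hI (coordChange_mem_map_iff.1 hf) l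

theorem eval_coordChange (α : GL (Fin n) k) (b : Fin n → k) (f : MvPolynomial (Fin n) k) :
    eval b (coordChange α f) = eval (fun j => ∑ i, α.val i j * b i) f := by
  have : (aeval b).comp (coordChange α) =
      aeval (R := k) fun j => ∑ i, α.val i j * b i := by
    ext j : 1
    simp [coordChange_X]
  simpa [coe_aeval_eq_eval] using DFunLike.congr_fun this f

theorem coeff_single_eq_eval {σ R : Type*} [CommSemiring R] [Finite σ] [DecidableEq σ]
    {f : MvPolynomial σ R} {l : ℕ} (hf : f.IsHomogeneous l) (i : σ) :
    coeff (Finsupp.single i l) f = eval (Pi.single i 1) f := by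
  have := Fintype.ofFinite σ
  rw [eval_eq', Finset.sum_eq_single (Finsupp.single i l)]
  · rw [Finset.prod_eq_one, mul_one]
    intro j _
    by_cases h : j = i
    · simp [h]
    · simp [Ne.symm h]
  · intro w hw hne
    obtain ⟨j, hji, hj⟩ : ∃ j, j ≠ i ∧ w j ≠ 0 := by
      by_contra! h
      obtain ⟨a, rfl⟩ : ∃ a, w = Finsupp.single i a :=
        ⟨w i, Finsupp.eq_single_iff.2 ⟨fun j hj => by
          by_contra hji
          exact Finsupp.mem_support_iff.1 hj (h j (by simpa using hji)), rfl⟩⟩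
      refine mem_support_iff.1 hw (hf.coeff_eq_zero ?_)
      rwa [Finsupp.degree_single, ← (Finsupp.single_injective i).ne_iff]
    rw [Finset.prod_eq_zero (Finset.mem_univ j), mul_zero]
    rw [Pi.single_eq_of_ne hji, zero_pow hj]
  · intro h
    rw [notMem_support_iff.1 h, zero_mul]

theorem homogeneousComponent_totalDegree_ne_zero {σ R : Type*} [CommSemiring R]
    {g : MvPolynomial σ R} (hg : g ≠ 0) : homogeneousComponent g.totalDegree g ≠ 0 := by
  obtain ⟨w, hw, h⟩ := Finset.exists_mem_eq_sup g.support (support_nonempty.2 hg)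
    fun s => s.sum fun _ e => e
  rw [ne_zero_iff]
  refine ⟨w, ?_⟩
  rw [coeff_homogeneousComponent, if_pos (show w.degree = g.totalDegree from h.symm)]
  exact mem_support_iff.1 hw

theorem coeff_single_coordChange (α : GL (Fin n) k) (g : MvPolynomial (Fin n) k) (l : ℕ)
    (i : Fin n) :
    coeff (Finsupp.single i l) (coordChange α g) =
      eval (α.val i) (homogeneousComponent l g) := by
  have hhom := homogeneousComponent_isHomogeneous l (coordChange α g)
  have := coeff_single_eq_eval hhom i
  rw [coeff_homogeneousComponent, if_pos (Finsupp.degree_single i l)] at this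
  rw [this, ← coordChange_homogeneousComponent, eval_coordChange]
  congr 2
  ext j
  simp [Pi.single_apply]

end CoordChange

/-! ### Generic coordinates -/

section Generic

variable {k : Type*} [Field k]

theorem IsZariskiOpen.exists_mem_eval_ne_zero [Infinite k] {n : ℕ} {U : Set (GL (Fin n) k)}
    (hU : IsZariskiOpen U) (hne : U.Nonempty) {G : MvPolynomial (Fin n × Fin n) k} (hG : G ≠ 0) :
    ∃ α ∈ U, eval (fun p => α.val p.1 p.2) G ≠ 0 := by
  obtain ⟨T, rfl⟩ := hU
  obtain ⟨α, F, hFT, hF⟩ := hne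
  have hF0 : F ≠ 0 := by
    rintro rfl
    exact hF (map_zero _)
  have hdet := Matrix.det_mvPolynomialX_ne_zero (Fin n) k
  obtain ⟨b, hb⟩ : ∃ b, eval b (F * G * (Matrix.mvPolynomialX (Fin n) (Fin n) k).det) ≠ 0 := by
    by_contra! h
    exact mul_ne_zero (mul_ne_zero hF0 hG) hdet (MvPolynomial.funext fun b => by
      rw [h b, map_zero])
  rw [map_mul, map_mul] at hb
  have hbdet : (Matrix.of fun i j => b (i, j)).det ≠ 0 := by
    rw [← Matrix.mvPolynomialX_mapMatrix_eval (Matrix.of fun i j => b (i, j)), ← RingHom.map_det]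
    exact right_ne_zero_of_mul hb
  exact ⟨Matrix.GeneralLinearGroup.mkOfDetNeZero _ hbdet,
    ⟨F, hFT, left_ne_zero_of_mul (left_ne_zero_of_mul hb)⟩,
    right_ne_zero_of_mul (left_ne_zero_of_mul hb)⟩

variable {c d : ℕ}

/-- The linear changes of coordinates of the last `d` variables alone. -/
def blockGL (c : ℕ) {d : ℕ} : GL (Fin d) k →* GL (Fin (c + d)) k :=
  Units.map
    { toFun B := Matrix.reindex finSumFinEquiv finSumFinEquiv (Matrix.fromBlocks 1 0 0 B)
      map_one' := by simp
      map_mul' A B := by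
        simp only [Matrix.reindex_apply, Matrix.submatrix_mul_equiv, Matrix.fromBlocks_multiply]
        simp }

theorem blockGL_val (B : GL (Fin d) k) :
    (blockGL c B).val =
      Matrix.reindex finSumFinEquiv finSumFinEquiv (Matrix.fromBlocks 1 0 0 B.val) :=
  rfl

theorem split_coordChange_blockGL (B : GL (Fin d) k) (f : MvPolynomial (Fin (c + d)) k) :
    split finSumFinEquiv.symm (coordChange (blockGL c B) f) =
      map (coordChange B : _ →+* _) (split finSumFinEquiv.symm f) := by
  have : ((split finSumFinEquiv.symm).toAlgHom.restrictScalars k).comp (coordChange (blockGL c B)) =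
      (mapAlgHom (coordChange B)).comp
        ((split finSumFinEquiv.symm).toAlgHom.restrictScalars k) := by
    ext j : 1
    obtain ⟨j | j, rfl⟩ := finSumFinEquiv.surjective j
    · simp [coordChange_X, ← finSumFinEquiv.sum_comp, blockGL_val, split, Matrix.one_apply]
    · simp [coordChange_X, ← finSumFinEquiv.sum_comp, blockGL_val, split]
  exact DFunLike.congr_fun this f

theorem IsZariskiOpen.preimage_blockGL_mul {U : Set (GL (Fin (c + d)) k)} (hU : IsZariskiOpen U)
    (α : GL (Fin (c + d)) k) : IsZariskiOpen {B : GL (Fin d) k | blockGL c B * α ∈ U} := by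
  obtain ⟨T, rfl⟩ := hU
  let M : Matrix (Fin (c + d)) (Fin (c + d)) (MvPolynomial (Fin d × Fin d) k) :=
    Matrix.reindex finSumFinEquiv finSumFinEquiv
      (Matrix.fromBlocks 1 0 0 (Matrix.mvPolynomialX (Fin d) (Fin d) k)) * α.val.map C
  refine ⟨(bind₁ fun p : Fin (c + d) × Fin (c + d) => M p.1 p.2) '' T, Set.ext fun B => ?_⟩
  have hM : (eval fun p : Fin d × Fin d => B.val p.1 p.2).mapMatrix M = (blockGL c B * α).val := by
    have hX := Matrix.mvPolynomialX_mapMatrix_eval B.val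
    rw [RingHom.mapMatrix_apply] at hX
    rw [map_mul, Units.val_mul, blockGL_val, ← hX, RingHom.mapMatrix_apply,
      RingHom.mapMatrix_apply, Matrix.map_map, Matrix.reindex_apply, Matrix.reindex_apply,
      ← Matrix.submatrix_map, Matrix.fromBlocks_map]
    congr 1
    · simp
    · ext; simp
  have heval (F : MvPolynomial (Fin (c + d) × Fin (c + d)) k) :
      eval (fun p => B.val p.1 p.2) (bind₁ (fun p => M p.1 p.2) F) =
        eval (fun p => (blockGL c B * α).val p.1 p.2) F := by
    simp only [← hM, ← coe_aeval_eq_eval, RingHom.coe_coe, aeval_bind₁]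
    rfl
  simp only [Set.mem_ofPred_eq, Set.exists_mem_image, heval]

theorem exists_blockGL_mul_mem [Infinite k] {U : Set (GL (Fin (c + d)) k)} (hU : IsZariskiOpen U)
    {α : GL (Fin (c + d)) k} (hα : α ∈ U) {g : MvPolynomial (Fin d) k} (hg : g ≠ 0) (i : Fin d) :
    ∃ B : GL (Fin d) k, blockGL c B * α ∈ U ∧
      coeff (Finsupp.single i g.totalDegree) (coordChange B g) ≠ 0 := by
  have hG : rename (fun j => (i, j)) (homogeneousComponent g.totalDegree g) ≠ 0 := by
    rw [Ne, map_eq_zero_iff _ (rename_injective _ (Prod.mk_right_injective i))]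
    exact homogeneousComponent_totalDegree_ne_zero hg
  obtain ⟨B, hB, hBG⟩ := (hU.preimage_blockGL_mul α).exists_mem_eval_ne_zero
    ⟨1, by rwa [Set.mem_ofPred_eq, map_one, one_mul]⟩ hG
  refine ⟨B, hB, ?_⟩
  rwa [coeff_single_coordChange, ← Function.comp_def (f := fun p : Fin d × Fin d => B.val p.1 p.2),
    eval_rename] at *

end Generic

theorem toRevLex_lt_of_tail {n j : ℕ} {v w : Fin n →₀ ℕ} (hdeg : v.degree = w.degree)
    (hv : ∃ l : Fin n, j ≤ l ∧ v l ≠ 0) (hw : ∀ l : Fin n, j ≤ l → w l = 0) :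
    toRevLex v < toRevLex w := by
  obtain ⟨l, hjl, hl⟩ := hv
  have hne : v.support.Nonempty := ⟨l, Finsupp.mem_support_iff.2 hl⟩
  have hle : ∀ i, v i ≠ 0 → i ≤ v.support.max' hne :=
    fun i hi => Finset.le_max' _ _ (Finsupp.mem_support_iff.2 hi)
  have hmem := Finsupp.mem_support_iff.1 (Finset.max'_mem _ hne)
  set i := v.support.max' hne
  have hji : j ≤ i := hjl.trans (hle l hl)
  refine RevLex.lt_iff.2 (Or.inr ⟨hdeg, i, fun a ha => ?_, ?_⟩)
  · rw [hw a (hji.trans (Fin.le_def.1 ha.le))]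
    by_contra h
    exact absurd (hle a h) (not_le.2 ha)
  · rw [hw i hji]
    exact Nat.pos_of_ne_zero hmem

section Noether

variable {k : Type*} [Field k] {n c d : ℕ}

theorem degree_inclRight_eq_single [NeZero d] {h : MvPolynomial (Fin d) k} {N : ℕ}
    (hN : h.totalDegree ≤ N) (hcoeff : coeff (Finsupp.single 0 N) h ≠ 0) :
    (degRevLex (c + d)).degree (inclRight finSumFinEquiv.symm h) =
      Finsupp.single (Fin.natAdd c 0) N := by
  have hsingle : joinExp (finSumFinEquiv (m := c) (n := d)).symm (0, Finsupp.single 0 N) =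
      Finsupp.single (Fin.natAdd c 0) N := joinExp_single_right _ _ _
  refine degree_eq_of_forall_le ?_ fun v hv => ?_
  · rwa [mem_support_iff, ← hsingle, coeff_joinExp_zero_inclRight]
  obtain ⟨t, ht, rfl⟩ := (mem_support_inclRight _).1 hv
  have hdeg : t.degree ≤ N := (le_totalDegree ht).trans hN
  rw [← hsingle]
  by_cases! hl : ∃ l, l ≠ 0 ∧ t l ≠ 0
  · obtain ⟨l, hl0, hl⟩ := hl
    rcases hdeg.lt_or_eq with hlt | heq
    · refine le_of_lt (RevLex.lt_iff.2 (Or.inl ?_))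
      rwa [degree_joinExp, degree_joinExp, Finsupp.degree_single, add_lt_add_iff_left]
    refine le_of_lt (toRevLex_lt_of_tail (j := c + 1) ?_ ⟨Fin.natAdd c l, ?_, ?_⟩ fun i hi => ?_)
    · rw [degree_joinExp, degree_joinExp, heq, Finsupp.degree_single]
    · rw [Fin.val_natAdd]
      exact Nat.add_le_add_left (Fin.pos_iff_ne_zero.2 hl0) c
    · exact (joinExp_apply_inr _ _ _ l).trans_ne hl
    · refine hsingle ▸ Finsupp.single_eq_of_ne ?_
      rintro rfl
      simp at hi
  · refine (degRevLex (c + d)).toSyn_monotone ((joinExp_le_joinExp _).2 ⟨le_rfl, fun l => ?_⟩)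
    rcases eq_or_ne l 0 with rfl | hl0
    · rw [Finsupp.single_eq_same]
      exact (Finsupp.le_degree 0 t).trans hdeg
    · exact (hl l hl0).trans_le zero_le

/-- The changes of coordinates in the Zariski open set `U` all give the ideal `I` the same set `E`
of leading exponents. -/
structure HasLeadExpsOn (U : Set (GL (Fin n) k)) (I : Ideal (MvPolynomial (Fin n) k))
    (E : Set (Fin n →₀ ℕ)) : Prop where
  isZariskiOpen : IsZariskiOpen U
  leadExps_eq : ∀ α ∈ U, leadExps (degRevLex n) (I.map (coordChange α)) = E

theorem coordChange_blockGL_inclRight (B : GL (Fin d) k) (g : MvPolynomial (Fin d) k) :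
    coordChange (blockGL c B) (inclRight finSumFinEquiv.symm g) =
      inclRight finSumFinEquiv.symm (coordChange B g) := by
  apply (split finSumFinEquiv.symm).injective
  rw [split_coordChange_blockGL, split_inclRight, split_inclRight, map_C]
  rfl

theorem HasLeadExpsOn.exists_single_mem [Infinite k] [NeZero d] {U : Set (GL (Fin (c + d)) k)}
    {I : Ideal (MvPolynomial (Fin (c + d)) k)} {E : Set (Fin (c + d) →₀ ℕ)}
    (h : HasLeadExpsOn U I E) {α : GL (Fin (c + d)) k} (hα : α ∈ U)
    {g : MvPolynomial (Fin d) k} (hg0 : g ≠ 0)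
    (hg : inclRight finSumFinEquiv.symm g ∈ I.map (coordChange α)) :
    ∃ N, Finsupp.single (Fin.natAdd c 0) N ∈ E := by
  obtain ⟨B, hB, hBg⟩ := exists_blockGL_mul_mem h.isZariskiOpen hα hg0 0
  refine ⟨g.totalDegree, h.leadExps_eq _ hB ▸ ⟨_, ?_, ?_,
    degree_inclRight_eq_single (totalDegree_coordChange_le B g) hBg⟩⟩
  · rw [map_coordChange_mul, ← coordChange_blockGL_inclRight]
    exact coordChange_mem_map_iff.2 hg
  · intro h0
    rw [← coeff_joinExp_zero_inclRight finSumFinEquiv.symm, h0, coeff_zero] at hBg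
    exact hBg rfl

theorem HasLeadExpsOn.exists_single_mem_of_lt [Infinite k] {U : Set (GL (Fin n) k)}
    {I : Ideal (MvPolynomial (Fin n) k)} {E : Set (Fin n →₀ ℕ)} (h : HasLeadExpsOn U I E)
    (hne : U.Nonempty) (hc : c + d = n)
    (hd : ringKrullDim (MvPolynomial (Fin n) k ⧸ I) = (d : WithBot ℕ∞)) (i : Fin n)
    (hi : (i : ℕ) < c) : ∃ N, Finsupp.single i N ∈ E := by
  obtain ⟨α, hα⟩ := hne
  obtain ⟨r, hr⟩ := i
  induction r using Nat.strong_induction_on with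
  | _ r ih =>
    obtain ⟨b, rfl⟩ : ∃ b, n = r + (b + 1) := ⟨n - r - 1, by omega⟩
    have hpow (j : Fin r) : ∃ N, Finsupp.single (finSumFinEquiv.symm.symm (Sum.inl j)) N ∈
        leadExps (degRevLex (r + (b + 1))) (I.map (coordChange α)) := by
      rw [h.leadExps_eq α hα]
      exact ih j j.2 (by omega) (j.2.trans hi)
    have hdim := ringKrullDim_quotient_eq_iff (ρ := Fin (b + 1)) finSumFinEquiv.symm hpow
    rw [ringKrullDim_quotient_map_coordChange, hd, Nat.card_fin] at hdim
    obtain ⟨g, hg, hg0⟩ : ∃ g, inclRight finSumFinEquiv.symm g ∈ I.map (coordChange α) ∧ g ≠ 0 := by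
      by_contra! hinj
      have : d = b + 1 := by exact_mod_cast hdim.2 hinj
      simp only at hi
      omega
    exact h.exists_single_mem hα hg0 hg

/-- The quotient by `I` is unmixed: every associated prime of `I` has the dimension of `I`. -/
def IsUnmixed {R : Type*} [CommRing R] (I : Ideal R) : Prop :=
  ∀ p ∈ associatedPrimes R (R ⧸ I), ringKrullDim (R ⧸ p) = ringKrullDim (R ⧸ I)

theorem IsUnmixed.exists_mem_of_mul_mem {R : Type*} [CommRing R] [IsNoetherianRing R] {I : Ideal R}
    (hI : IsUnmixed I) {a f : R} (haf : a * f ∈ I) (hf : f ∉ I) :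
    ∃ p, I ≤ p ∧ a ∈ p ∧ ringKrullDim (R ⧸ p) = ringKrullDim (R ⧸ I) := by
  have hf0 : Ideal.Quotient.mk I f ≠ 0 := by rwa [Ne, Ideal.Quotient.eq_zero_iff_mem]
  obtain ⟨p, hp, hle⟩ := exists_le_isAssociatedPrime_of_isNoetherianRing R _ hf0
  refine ⟨p, fun b hb => hle ?_, hle ?_, hI p hp⟩ <;>
    rw [Submodule.mem_colon_singleton, Submodule.mem_bot, Algebra.smul_def,
      Ideal.Quotient.algebraMap_eq, ← map_mul, Ideal.Quotient.eq_zero_iff_mem]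
  exacts [I.mul_mem_right _ hb, haf]

theorem IsUnmixed.mem_of_inclRight_mul_mem {I : Ideal (MvPolynomial (Fin (c + d)) k)}
    (hI : IsUnmixed I)
    (hd : ringKrullDim (MvPolynomial (Fin (c + d)) k ⧸ I) = (d : WithBot ℕ∞))
    {α : GL (Fin (c + d)) k}
    (hpow : ∀ i : Fin c, ∃ N, Finsupp.single (Fin.castAdd d i) N ∈
      leadExps (degRevLex (c + d)) (I.map (coordChange α)))
    {a : MvPolynomial (Fin d) k} (ha : a ≠ 0) {f : MvPolynomial (Fin (c + d)) k}
    (haf : inclRight finSumFinEquiv.symm a * f ∈ I.map (coordChange α)) :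
    f ∈ I.map (coordChange α) := by
  obtain ⟨f, rfl⟩ := (coordEquiv α).surjective f
  obtain ⟨b, hb⟩ := (coordEquiv α).surjective (inclRight finSumFinEquiv.symm a)
  rw [← hb, ← map_mul] at haf
  by_contra hf
  obtain ⟨p, hIp, hbp, hp⟩ := hI.exists_mem_of_mul_mem (coordChange_mem_map_iff.1 haf)
    fun h => hf (coordChange_mem_map_iff.2 h)
  have hdim := ringKrullDim_quotient_eq_iff (ρ := Fin d) finSumFinEquiv.symm fun i =>
    (hpow i).imp fun N hN => leadExps_mono (Ideal.map_mono hIp) hN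
  rw [ringKrullDim_quotient_map_coordChange, hp, hd, Nat.card_fin] at hdim
  exact ha (hdim.1 rfl a (hb ▸ coordChange_mem_map_iff.2 hbp))

end Noether

/-! ### Relations between the standard monomials -/

section Relations

section GCDMonoid

variable {R M ι : Type*} [CommRing R] [IsDomain R] [IsGCDMonoid R] [AddCommGroup M] [Module R M]
  (b : Module.Basis ι R M)

theorem exists_eq_smul_primitive {x : M} (hx : x ≠ 0) :
    ∃ (a : R) (y : M), a ≠ 0 ∧ x = a • y ∧ ∀ r s, (∀ j, r ∣ s * b.repr y j) → r ∣ s := by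
  obtain ⟨_⟩ : Nonempty (NormalizedGCDMonoid R) := inferInstance
  set S := (b.repr x).support
  have hS : S.Nonempty := Finsupp.support_nonempty_iff.2 (b.repr.map_eq_zero_iff.not.2 hx)
  obtain ⟨g, hg, hgcd⟩ := S.extract_gcd (b.repr x) hS
  have ha : S.gcd (b.repr x) ≠ 0 := by
    obtain ⟨j, hj⟩ := hS
    exact left_ne_zero_of_mul (hg j hj ▸ Finsupp.mem_support_iff.1 hj)
  have hxy : x = S.gcd (b.repr x) • ∑ j ∈ S, g j • b j := by
    conv_lhs => rw [← b.linearCombination_repr x]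
    rw [Finsupp.linearCombination_apply, Finsupp.sum, Finset.smul_sum]
    exact Finset.sum_congr rfl fun j hj => by rw [smul_smul, ← hg j hj]
  refine ⟨_, _, ha, hxy, fun r s hrs => ?_⟩
  rw [← mul_one s, ← hgcd, ← (S.gcd_mul_left' g s).dvd_iff_dvd_right]
  refine Finset.dvd_gcd fun j hj => ?_
  convert hrs j using 2
  apply mul_left_cancel₀ ha
  rw [← hg j hj, ← smul_eq_mul, ← Finsupp.smul_apply, ← map_smul, ← hxy]

theorem isPrincipal_of_saturated_of_injOn_repr {N : Submodule R M}
    (hN : ∀ r : R, r ≠ 0 → ∀ x, r • x ∈ N → x ∈ N) {i : ι}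
    (hi : ∀ x ∈ N, b.repr x i = 0 → x = 0) : N.IsPrincipal := by
  rcases eq_or_ne N ⊥ with rfl | hN0
  · infer_instance
  obtain ⟨x, hx, hx0⟩ := N.exists_mem_ne_zero_of_ne_bot hN0
  obtain ⟨a, y, ha, rfl, hy⟩ := exists_eq_smul_primitive b hx0
  have hyN : y ∈ N := hN _ ha y hx
  have hy0 : b.repr y i ≠ 0 := fun h => hx0 (by rw [hi y hyN h, smul_zero])
  refine ⟨y, le_antisymm (fun z hz => ?_) ((Submodule.span_singleton_le_iff_mem y N).2 hyN)⟩
  have hyz : b.repr z i • y = b.repr y i • z := by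
    refine sub_eq_zero.1 (hi _ (N.sub_mem (N.smul_mem _ hyN) (N.smul_mem _ hz)) ?_)
    simp [mul_comm]
  obtain ⟨r, hr⟩ : b.repr y i ∣ b.repr z i := hy _ _ fun j => ⟨b.repr z j, by
    rw [← smul_eq_mul, ← smul_eq_mul, ← Finsupp.smul_apply, ← map_smul, hyz, map_smul,
      Finsupp.smul_apply]⟩
  have : Module.IsTorsionFree R M := b.isTorsionFree
  refine Submodule.mem_span_singleton.2 ⟨r, smul_right_injective M hy0 ?_⟩
  change b.repr y i • r • y = b.repr y i • z
  rw [smul_smul, ← hr, hyz]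

end GCDMonoid

variable {σ τ ρ k : Type*} [Field k]

/-- The relations modulo `Q` between the monomials in the variables `τ` with exponent not in `V`,
with polynomials in the variables `ρ` as coefficients. -/
def relations (e : σ ≃ τ ⊕ ρ) (Q : Ideal (MvPolynomial σ k)) (V : Set (τ →₀ ℕ)) :
    Submodule (MvPolynomial ρ k) (MvPolynomial τ (MvPolynomial ρ k)) where
  carrier := {F | (split e).symm F ∈ Q ∧ ∀ v ∈ V, coeff v F = 0}
  zero_mem' := by simp
  add_mem' := fun ⟨h, hV⟩ ⟨h', hV'⟩ =>
    ⟨by rw [map_add]; exact Q.add_mem h h',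
      fun v hv => by rw [coeff_add, hV v hv, hV' v hv, add_zero]⟩
  smul_mem' := fun a F ⟨h, hV⟩ => by
    refine ⟨?_, fun v hv => by rw [coeff_smul, hV v hv, smul_zero]⟩
    rw [smul_eq_C_mul, map_mul]
    exact Q.mul_mem_left _ h

variable {e : σ ≃ τ ⊕ ρ} {Q : Ideal (MvPolynomial σ k)} {m : MonomialOrder σ} {u : τ →₀ ℕ}
  {F : MvPolynomial τ (MvPolynomial ρ k)}

theorem symm_split_C (a : MvPolynomial ρ k) : (split e).symm (C a) = inclRight e a :=
  (split e).symm_apply_eq.2 (split_inclRight e a).symm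

theorem exists_degree_eq_joinExp_of_mem_relations
    (hu : projExps e (leadExps m Q) \ sectionExps e (leadExps m Q) = {u})
    (hF : F ∈ relations e Q (sectionExps e (leadExps m Q))) (hF0 : F ≠ 0) :
    ∃ t ∈ (coeff u F).support, m.degree ((split e).symm F) = joinExp e (u, t) := by
  have hf0 : (split e).symm F ≠ 0 := (map_ne_zero_iff _ (split e).symm.injective).2 hF0
  obtain ⟨⟨v, t⟩, hvt⟩ := (joinExp e).surjective (m.degree ((split e).symm F))
  have hcoeff := m.leadingCoeff_ne_zero_iff.2 hf0
  rw [MonomialOrder.leadingCoeff, ← hvt, ← coeff_coeff_split, AlgEquiv.apply_symm_apply] at hcoeff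
  obtain rfl : v = u := by
    refine hu.subset ⟨⟨t, hvt ▸ ⟨_, hF.1, hf0, rfl⟩⟩, fun hv => hcoeff ?_⟩
    rw [hF.2 v hv, coeff_zero]
  exact ⟨t, mem_support_iff.2 hcoeff, hvt.symm⟩

theorem degree_symm_split_eq_of_mem_relations
    (hu : projExps e (leadExps m Q) \ sectionExps e (leadExps m Q) = {u})
    (hF : F ∈ relations e Q (sectionExps e (leadExps m Q))) (hF0 : F ≠ 0) :
    m.degree ((split e).symm F) = joinExp e (u, 0) + m.degree (inclRight e (coeff u F)) := by
  obtain ⟨t, ht, hFt⟩ := exists_degree_eq_joinExp_of_mem_relations hu hF hF0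
  have hmem (s : ρ →₀ ℕ) (hs : s ∈ (coeff u F).support) :
      joinExp e (u, s) ∈ ((split e).symm F).support := by
    rwa [mem_support_iff, ← coeff_coeff_split, AlgEquiv.apply_symm_apply, ← mem_support_iff]
  suffices m.degree (inclRight e (coeff u F)) = joinExp e (0, t) by
    rw [hFt, this, ← joinExp_eq_add]
  refine degree_eq_of_forall_le ((mem_support_inclRight e).2 ⟨t, ht, rfl⟩) fun w hw => ?_
  obtain ⟨s, hs, rfl⟩ := (mem_support_inclRight e).1 hw
  have hle := m.le_degree (hmem s hs)
  rwa [hFt, joinExp_eq_add, joinExp_eq_add e u t, map_add, map_add, add_le_add_iff_left] at hle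

theorem exists_relation_of_mem_leadExps {v : τ →₀ ℕ} {t : ρ →₀ ℕ}
    (hv : v ∉ sectionExps e (leadExps m Q)) (hvt : joinExp e (v, t) ∈ leadExps m Q) :
    ∃ F ∈ relations e Q (sectionExps e (leadExps m Q)), F ≠ 0 ∧
      m.degree ((split e).symm F) = joinExp e (v, t) := by
  obtain ⟨f, hf, hf0, hdeg, hsupp⟩ := exists_reduced_of_mem_leadExps
    (cylinder_sectionExps_subset (e := e) (isUpperSet_leadExps m Q)) hvt
    (mt joinExp_mem_cylinder.1 hv)
  refine ⟨split e f, ⟨by rwa [AlgEquiv.symm_apply_apply], fun v' hv' => ?_⟩,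
    (map_ne_zero_iff _ (split e).injective).2 hf0, by rwa [AlgEquiv.symm_apply_apply]⟩
  ext t'
  rw [coeff_coeff_split, coeff_zero]
  by_contra h
  exact hsupp _ (mem_support_iff.2 h) (joinExp_mem_cylinder.2 hv')

theorem relations_isPrincipal
    (hQ : ∀ a : MvPolynomial ρ k, a ≠ 0 → ∀ f, inclRight e a * f ∈ Q → f ∈ Q)
    (hu : projExps e (leadExps m Q) \ sectionExps e (leadExps m Q) = {u}) :
    (relations e Q (sectionExps e (leadExps m Q))).IsPrincipal := by
  refine isPrincipal_of_saturated_of_injOn_repr (basisMonomials τ (MvPolynomial ρ k))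
    (fun a ha F hF => ⟨hQ a ha _ ?_, fun v hv => ?_⟩) (i := u) fun F hF h0 => ?_
  · rw [← symm_split_C, ← map_mul, ← smul_eq_C_mul]
    exact hF.1
  · exact (mul_eq_zero.1 ((coeff_smul _ _ _).symm.trans (hF.2 v hv))).resolve_left ha
  · by_contra hF0
    obtain ⟨t, ht, -⟩ := exists_degree_eq_joinExp_of_mem_relations hu hF hF0
    rw [show coeff u F = 0 from h0] at ht
    simp at ht

theorem exists_forall_joinExp_mem_leadExps_iff
    (hQ : ∀ a : MvPolynomial ρ k, a ≠ 0 → ∀ f, inclRight e a * f ∈ Q → f ∈ Q)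
    (hu : projExps e (leadExps m Q) \ sectionExps e (leadExps m Q) = {u}) :
    ∃ t₀, ∀ t, joinExp e (u, t) ∈ leadExps m Q ↔ t₀ ≤ t := by
  obtain ⟨⟨t, ht⟩, huE⟩ : u ∈ projExps e (leadExps m Q) \ sectionExps e (leadExps m Q) :=
    hu ▸ rfl
  obtain ⟨G, hG⟩ := relations_isPrincipal hQ hu
  have hGmem : G ∈ relations e Q (sectionExps e (leadExps m Q)) :=
    hG ▸ Submodule.mem_span_singleton_self G
  have hdvd (t : ρ →₀ ℕ) (ht : joinExp e (u, t) ∈ leadExps m Q) :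
      G ≠ 0 ∧ m.degree ((split e).symm G) ≤ joinExp e (u, t) := by
    obtain ⟨F, hF, hF0, hFt⟩ := exists_relation_of_mem_leadExps huE ht
    rw [hG, Submodule.mem_span_singleton] at hF
    obtain ⟨a, rfl⟩ := hF
    rw [smul_eq_C_mul] at hF0 hFt
    have hinj {F} := map_ne_zero_iff (x := F) _ (split (R := k) e).symm.injective
    rw [map_mul, MonomialOrder.degree_mul (hinj.2 (left_ne_zero_of_mul hF0))
      (hinj.2 (right_ne_zero_of_mul hF0))] at hFt
    exact ⟨right_ne_zero_of_mul hF0, hFt ▸ le_add_self⟩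
  have hG0 := (hdvd t ht).1
  obtain ⟨t₀, -, ht₀⟩ := exists_degree_eq_joinExp_of_mem_relations hu hGmem hG0
  refine ⟨t₀, fun t => ⟨fun ht => ?_, fun h => ?_⟩⟩
  · exact ((joinExp_le_joinExp e).1 (ht₀ ▸ (hdvd t ht).2)).2
  · refine isUpperSet_leadExps m Q ((joinExp_le_joinExp e).2 ⟨le_rfl, h⟩) ?_
    exact ht₀ ▸ ⟨_, hGmem.1, (map_ne_zero_iff _ (split e).symm.injective).2 hG0, rfl⟩

end Relations

section Shape

variable {k : Type*} [Field k] {c d : ℕ}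

theorem map_coordChange_mem_relations {Q : Ideal (MvPolynomial (Fin (c + d)) k)}
    {V : Set (Fin c →₀ ℕ)} {F : MvPolynomial (Fin c) (MvPolynomial (Fin d) k)}
    (hF : F ∈ relations finSumFinEquiv.symm Q V) (B : GL (Fin d) k) :
    map (coordChange B : MvPolynomial (Fin d) k →+* MvPolynomial (Fin d) k) F ∈
      relations finSumFinEquiv.symm (Q.map (coordChange (blockGL c B))) V := by
  refine ⟨?_, fun v hv => by rw [coeff_map, hF.2 v hv, map_zero]⟩
  obtain ⟨f, rfl⟩ := (split finSumFinEquiv.symm).surjective F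
  have hf : f ∈ Q := (split finSumFinEquiv.symm).symm_apply_apply f ▸ hF.1
  rw [← split_coordChange_blockGL, AlgEquiv.symm_apply_apply]
  exact coordChange_mem_map_iff.2 hf

variable [Infinite k] [NeZero d] {U : Set (GL (Fin (c + d)) k)}
  {I : Ideal (MvPolynomial (Fin (c + d)) k)} {E : Set (Fin (c + d) →₀ ℕ)}
  {α : GL (Fin (c + d)) k} {u : Fin c →₀ ℕ}

theorem HasLeadExpsOn.exists_joinExp_single_mem (h : HasLeadExpsOn U I E) (hα : α ∈ U)
    (hu : projExps finSumFinEquiv.symm E \ sectionExps finSumFinEquiv.symm E = {u}) :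
    ∃ N, joinExp finSumFinEquiv.symm (u, Finsupp.single (0 : Fin d) N) ∈ E := by
  obtain ⟨⟨t, ht⟩, huE⟩ := hu.symm.subset rfl
  have huα := hu
  rw [← h.leadExps_eq α hα] at huα ht huE
  obtain ⟨F, hF, hF0, -⟩ := exists_relation_of_mem_leadExps huE ht
  obtain ⟨t', ht', -⟩ := exists_degree_eq_joinExp_of_mem_relations huα hF hF0
  have hg0 : coeff u F ≠ 0 := support_nonempty.1 ⟨t', ht'⟩
  obtain ⟨B, hB, hBg⟩ := exists_blockGL_mul_mem h.isZariskiOpen hα hg0 0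
  have hF' := map_coordChange_mem_relations hF B
  rw [← map_coordChange_mul] at hF'
  set F' := map (coordChange B : MvPolynomial (Fin d) k →+* MvPolynomial (Fin d) k) F
  have hcoeff : coeff u F' = coordChange B (coeff u F) := coeff_map _ _ _
  have hF'0 : F' ≠ 0 := by
    rintro h0
    rw [← hcoeff, h0, coeff_zero, coeff_zero] at hBg
    exact hBg rfl
  rw [h.leadExps_eq α hα, ← h.leadExps_eq _ hB] at hF'
  rw [← h.leadExps_eq _ hB] at hu
  have hdeg := degree_symm_split_eq_of_mem_relations hu hF' hF'0
  rw [hcoeff, degree_inclRight_eq_single (totalDegree_coordChange_le B _) hBg] at hdeg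
  refine ⟨(coeff u F).totalDegree, ?_⟩
  rw [← h.leadExps_eq _ hB, joinExp_eq_add, joinExp_single_right]
  exact hdeg ▸ ⟨_, hF'.1, (map_ne_zero_iff _ (split _).symm.injective).2 hF'0, rfl⟩

theorem HasLeadExpsOn.exists_forall_joinExp_mem_iff (h : HasLeadExpsOn U I E) (hα : α ∈ U)
    (hsat : ∀ a : MvPolynomial (Fin d) k, a ≠ 0 → ∀ f,
      inclRight finSumFinEquiv.symm a * f ∈ I.map (coordChange α) → f ∈ I.map (coordChange α))
    (hu : projExps finSumFinEquiv.symm E \ sectionExps finSumFinEquiv.symm E = {u}) :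
    ∃ N, ∀ t : Fin d →₀ ℕ, joinExp finSumFinEquiv.symm (u, t) ∈ E ↔ N ≤ t 0 := by
  obtain ⟨N, hN⟩ := h.exists_joinExp_single_mem hα hu
  rw [← h.leadExps_eq α hα] at hu hN ⊢
  obtain ⟨t₀, ht₀⟩ := exists_forall_joinExp_mem_leadExps_iff hsat hu
  have hsingle : t₀ = Finsupp.single 0 (t₀ 0) := by
    ext i
    rcases eq_or_ne i 0 with rfl | hi
    · rw [Finsupp.single_eq_same]
    · have := (ht₀ _).1 hN i
      rw [Finsupp.single_eq_of_ne hi] at this ⊢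
      exact Nat.le_zero.1 this
  refine ⟨t₀ 0, fun t => ?_⟩
  rw [ht₀, hsingle, Finsupp.single_le_iff, Finsupp.single_eq_same]

end Shape

/-! ### Regularity of the last variables -/

section LeadExpsRegular

variable {σ k : Type*} [Field k] {m : MonomialOrder σ} {I : Ideal (MvPolynomial σ k)}

theorem isSMulRegular_X_of_leadExps {j : σ}
    (hj : ∀ w, w + Finsupp.single j 1 ∈ leadExps m I → w ∈ leadExps m I) :
    IsSMulRegular (MvPolynomial σ k ⧸ I) (X j : MvPolynomial σ k) := by
  refine isSMulRegular_quotient_iff.2 fun f hf => ?_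
  obtain ⟨g, hfg, hg⟩ := exists_reduction (Set.Subset.refl (leadExps m I)) f
  suffices g = 0 by rwa [this, sub_zero] at hfg
  by_contra hg0
  have hXg : X j * g ∈ I := by
    have := I.sub_mem hf (I.mul_mem_left (X j) hfg)
    rwa [← mul_sub, sub_sub_cancel] at this
  refine (hg _ (m.degree_mem_support hg0)).1 (hj _ ⟨_, hXg, mul_ne_zero (X_ne_zero j) hg0, ?_⟩)
  rw [MonomialOrder.degree_mul (X_ne_zero j) hg0, MonomialOrder.degree_X, add_comm]

end LeadExpsRegular

section Homogeneous

variable {k : Type*} [Field k] {n : ℕ} {m : MonomialOrder (Fin n)}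
  {Q : Ideal (MvPolynomial (Fin n) k)}

theorem IsHomogeneousIdeal.exists_mem_support_of_mem_leadExps (hQ : IsHomogeneousIdeal Q)
    {w : Fin n →₀ ℕ} (hw : w ∈ leadExps m Q) :
    ∃ f ∈ Q, w ∈ f.support ∧
      ∀ v ∈ f.support, v.degree = w.degree ∧ m.toSyn v ≤ m.toSyn w := by
  obtain ⟨f, hf, hf0, rfl⟩ := hw
  refine ⟨_, homogeneousComponent_mem_of_mem hQ hf (m.degree f).degree, ?_, fun v hv => ?_⟩
  · rw [mem_support_iff, coeff_homogeneousComponent, if_pos rfl]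
    exact m.coeff_degree_ne_zero_iff.2 hf0
  · rw [mem_support_iff, coeff_homogeneousComponent, ne_eq, ite_eq_right_iff, Classical.not_imp]
      at hv
    exact ⟨hv.1, m.le_degree (mem_support_iff.2 hv.2)⟩

theorem IsHomogeneousIdeal.idealOfVars_le_radical (hQ : IsHomogeneousIdeal Q)
    (hfin : (leadExps m Q)ᶜ.Finite) : idealOfVars (Fin n) k ≤ Q.radical := by
  obtain ⟨b, hb⟩ := (hfin.image Finsupp.degree).bddAbove
  have mem_leadExps {w : Fin n →₀ ℕ} (hw : b < w.degree) : w ∈ leadExps m Q := by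
    by_contra h
    exact hw.not_ge (hb ⟨w, h, rfl⟩)
  refine Ideal.span_le.2 ?_
  rintro _ ⟨i, rfl⟩
  obtain ⟨g, hfg, hg⟩ := exists_reduction (Set.Subset.refl (leadExps m Q))
    ((X i : MvPolynomial (Fin n) k) ^ (b + 1))
  have hg0 : homogeneousComponent (b + 1) g = 0 := by
    refine homogeneousComponent_eq_zero' _ _ fun w hw hdeg => (hg w hw).1 (mem_leadExps ?_)
    rw [hdeg]
    exact b.lt_succ_self
  have := homogeneousComponent_mem_of_mem hQ hfg (b + 1)
  rw [map_sub, hg0, sub_zero, homogeneousComponent_of_mem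
    (isHomogeneous_X_pow i (b + 1)), if_pos rfl] at this
  exact ⟨b + 1, this⟩

end Homogeneous

section Tail

variable {k : Type*} [Field k] {n : ℕ} {Q : Ideal (MvPolynomial (Fin n) k)}

variable (k n) in
/-- The ideal generated by the variables after the first `j`. -/
def tailIdeal (j : ℕ) : Ideal (MvPolynomial (Fin n) k) :=
  Ideal.span (X '' {l : Fin n | j ≤ l})

theorem mem_tailIdeal_iff {j : ℕ} {f : MvPolynomial (Fin n) k} :
    f ∈ tailIdeal k n j ↔ ∀ w ∈ f.support, ∃ l : Fin n, j ≤ l ∧ w l ≠ 0 :=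
  mem_ideal_span_X_image

theorem tailIdeal_self : tailIdeal k n n = ⊥ := by
  rw [tailIdeal, show {l : Fin n | n ≤ (l : ℕ)} = ∅ from
    Set.eq_empty_of_forall_notMem fun l hl => absurd l.2 (not_lt.2 hl), Set.image_empty,
    Ideal.span_empty]

theorem tailIdeal_succ_sup (j : Fin n) :
    tailIdeal k n (j + 1) ⊔ Ideal.span {X j} = tailIdeal k n j := by
  rw [tailIdeal, tailIdeal, ← Ideal.span_union, ← Set.image_singleton, ← Set.image_union]
  congr 2
  ext l
  simp only [Set.mem_union, Set.mem_ofPred_eq, Set.mem_singleton_iff, Fin.ext_iff]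
  omega

attribute [local instance] MvPolynomial.gradedAlgebra in
theorem IsHomogeneousIdeal.sup_tailIdeal (hQ : IsHomogeneousIdeal Q) (j : ℕ) :
    IsHomogeneousIdeal (Q ⊔ tailIdeal k n j) := by
  refine Ideal.IsHomogeneous.sup hQ (Ideal.homogeneous_span _ _ ?_)
  rintro _ ⟨i, -, rfl⟩
  exact ⟨1, isHomogeneous_X k i⟩

theorem IsHomogeneousIdeal.mem_leadExps_of_mem_sup_tailIdeal (hQ : IsHomogeneousIdeal Q) {j : ℕ}
    {f : MvPolynomial (Fin n) k} (hf : f ∈ Q ⊔ tailIdeal k n j) {w : Fin n →₀ ℕ}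
    (hw : w ∈ f.support) (htail : ∀ l : Fin n, j ≤ l → w l = 0)
    (hle : ∀ v ∈ f.support, (∀ l : Fin n, j ≤ l → v l = 0) →
      (degRevLex n).toSyn v ≤ (degRevLex n).toSyn w) :
    w ∈ leadExps (degRevLex n) Q := by
  obtain ⟨q, hq, h, hh, rfl⟩ := Submodule.mem_sup.1 hf
  rw [mem_tailIdeal_iff] at hh
  have coeff_add_eq {v : Fin n →₀ ℕ} (hv : ∀ l : Fin n, j ≤ l → v l = 0) :
      coeff v (q + h) = coeff v q := by
    rw [coeff_add, add_eq_left, ← notMem_support_iff]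
    intro hvh
    obtain ⟨l, hl, hvl⟩ := hh v hvh
    exact hvl (hv l hl)
  refine mem_leadExps_of_forall_le (homogeneousComponent_mem_of_mem hQ hq w.degree) ?_
    fun v hv => ?_
  · rwa [mem_support_iff, coeff_homogeneousComponent, if_pos rfl, ← coeff_add_eq htail,
      ← mem_support_iff]
  · rw [mem_support_iff, coeff_homogeneousComponent, ne_eq, ite_eq_right_iff, Classical.not_imp]
      at hv
    by_cases! hvtail : ∀ l : Fin n, j ≤ l → v l = 0
    · exact hle v (mem_support_iff.2 (coeff_add_eq hvtail ▸ hv.2)) hvtail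
    · exact (toRevLex_lt_of_tail hv.1 hvtail htail).le

theorem IsHomogeneousIdeal.mem_leadExps_sup_tailIdeal_iff (hQ : IsHomogeneousIdeal Q) {j : ℕ}
    {w : Fin n →₀ ℕ} :
    w ∈ leadExps (degRevLex n) (Q ⊔ tailIdeal k n j) ↔
      w ∈ leadExps (degRevLex n) Q ∨ ∃ l : Fin n, j ≤ l ∧ w l ≠ 0 := by
  classical
  refine ⟨?_, ?_⟩
  · rintro ⟨f, hf, hf0, rfl⟩
    refine or_iff_not_imp_right.2 fun htail => ?_
    push Not at htail
    exact hQ.mem_leadExps_of_mem_sup_tailIdeal hf ((degRevLex n).degree_mem_support hf0) htail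
      fun v hv _ => (degRevLex n).le_degree hv
  · rintro (hw | htail)
    · exact leadExps_mono le_sup_left hw
    · have hsupp : (monomial w (1 : k)).support = {w} := by
        rw [support_monomial, if_neg one_ne_zero]
      refine leadExps_mono le_sup_right
        (mem_leadExps_of_forall_le (mem_tailIdeal_iff.2 ?_) (f := monomial w 1) ?_ ?_) <;>
        simp [hsupp, htail]

theorem IsHomogeneousIdeal.isSMulRegular_X_sup_tailIdeal (hQ : IsHomogeneousIdeal Q) {j : Fin n}
    (hj : ∀ w, w + Finsupp.single j 1 ∈ leadExps (degRevLex n) Q → w ∈ leadExps (degRevLex n) Q) :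
    IsSMulRegular (MvPolynomial (Fin n) k ⧸ (Q ⊔ tailIdeal k n (j + 1)))
      (X j : MvPolynomial (Fin n) k) := by
  refine isSMulRegular_X_of_leadExps (m := degRevLex n) fun w => ?_
  rw [hQ.mem_leadExps_sup_tailIdeal_iff, hQ.mem_leadExps_sup_tailIdeal_iff]
  refine Or.imp (hj w) fun ⟨l, hl, hwl⟩ => ⟨l, hl, ?_⟩
  have hne : l ≠ j := by
    rintro rfl
    omega
  rwa [Finsupp.add_apply, Finsupp.single_eq_of_ne hne, add_zero] at hwl

theorem coeff_add_single_eq_of_sub_mem_tailIdeal {s : Fin n} {f g : MvPolynomial (Fin n) k}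
    (h : f - X s * g ∈ tailIdeal k n (s + 1)) {v : Fin n →₀ ℕ} (hv : ∀ l, s < l → v l = 0) :
    coeff (v + Finsupp.single s 1) f = coeff v g := by
  rw [← coeff_X_mul v s g, add_comm v, ← sub_eq_zero, ← coeff_sub, ← notMem_support_iff]
  intro hmem
  obtain ⟨l, hl, hvl⟩ := mem_tailIdeal_iff.1 h _ hmem
  refine hvl ?_
  rw [Finsupp.add_apply, hv l (Fin.lt_def.2 hl), add_zero,
    Finsupp.single_eq_of_ne (Fin.lt_def.2 hl).ne']

theorem IsHomogeneousIdeal.not_isSMulRegular_X_sup_tailIdeal (hQ : IsHomogeneousIdeal Q)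
    {s : Fin n} {w : Fin n →₀ ℕ} (hw : w ∉ leadExps (degRevLex n) Q)
    (hws : w + Finsupp.single s 1 ∈ leadExps (degRevLex n) Q)
    (htail : ∀ l, s < l → w l = 0) :
    ¬ IsSMulRegular (MvPolynomial (Fin n) k ⧸ (Q ⊔ tailIdeal k n (s + 1)))
      (X s : MvPolynomial (Fin n) k) := by
  obtain ⟨f, hf, hwf, hle⟩ := hQ.exists_mem_support_of_mem_leadExps hws
  -- No term of `f` exceeds its leading term, which involves `X s`; so all involve `X s` or later.
  have hftail : f ∈ tailIdeal k n (s + 1) ⊔ Ideal.span {X s} := by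
    rw [tailIdeal_succ_sup, mem_tailIdeal_iff]
    intro v hv
    by_contra! h
    exact (hle v hv).2.not_gt (toRevLex_lt_of_tail (hle v hv).1.symm ⟨s, le_rfl, by simp⟩ h)
  obtain ⟨g, hg⟩ := mem_sup_span_singleton.1 hftail
  intro hreg
  have hgQ : g ∈ Q ⊔ tailIdeal k n (s + 1) := by
    refine isSMulRegular_quotient_iff.1 hreg g ?_
    rw [← sub_sub_cancel f (X s * g)]
    exact Submodule.sub_mem_sup hf hg
  refine hw (hQ.mem_leadExps_of_mem_sup_tailIdeal hgQ ?_ (fun l hl => htail l hl)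
    fun v hv hvt => ?_)
  · rwa [mem_support_iff, ← coeff_add_single_eq_of_sub_mem_tailIdeal hg htail, ← mem_support_iff]
  · refine le_of_add_le_add_right (a := (degRevLex n).toSyn (Finsupp.single s 1)) ?_
    rw [← map_add, ← map_add]
    refine (hle _ ?_).2
    rwa [mem_support_iff, coeff_add_single_eq_of_sub_mem_tailIdeal hg fun l hl => hvt l hl,
      ← mem_support_iff]

theorem IsHomogeneousIdeal.hasMaximalRegularSequence (hQ : IsHomogeneousIdeal Q) {r t : ℕ}
    (hrt : r + t = n) (hr : HasSocle (idealOfVars (Fin n) k) (Q ⊔ tailIdeal k n r))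
    (hreg : ∀ j : Fin n, r ≤ j → ∀ w, w + Finsupp.single j 1 ∈ leadExps (degRevLex n) Q →
      w ∈ leadExps (degRevLex n) Q) :
    HasMaximalRegularSequence (idealOfVars (Fin n) k) t Q := by
  suffices ∀ i, r + i ≤ n →
      HasMaximalRegularSequence (idealOfVars (Fin n) k) i (Q ⊔ tailIdeal k n (r + i)) by
    simpa only [hrt, tailIdeal_self, sup_bot_eq] using this t hrt.le
  intro i
  induction i with
  | zero => exact fun _ => hr
  | succ i ih =>
    intro hi
    obtain ⟨j, hj⟩ : ∃ j : Fin n, (j : ℕ) = r + i := ⟨⟨r + i, hi⟩, rfl⟩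
    have hX : (X j : MvPolynomial (Fin n) k) ∈ idealOfVars (Fin n) k := Ideal.subset_span ⟨j, rfl⟩
    have hXreg := hQ.isSMulRegular_X_sup_tailIdeal (hreg j (hj ▸ Nat.le_add_right r i))
    have hseq := ih (Nat.le_of_succ_le hi)
    rw [← hj, ← tailIdeal_succ_sup, ← sup_assoc] at hseq
    rw [← add_assoc, ← hj]
    exact ⟨X j, hX, hXreg, hseq⟩

end Tail

section AlmostCylinder

variable {k : Type*} [Field k] {c d : ℕ} {Q : Ideal (MvPolynomial (Fin (c + d)) k)}

theorem IsHomogeneousIdeal.idealOfVars_le_radical_sup_tailIdeal (hQ : IsHomogeneousIdeal Q)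
    (hpow : ∀ i : Fin c, ∃ N, Finsupp.single (Fin.castAdd d i) N ∈ leadExps (degRevLex (c + d)) Q) :
    idealOfVars (Fin (c + d)) k ≤ (Q ⊔ tailIdeal k (c + d) c).radical := by
  refine (hQ.sup_tailIdeal c).idealOfVars_le_radical (m := degRevLex (c + d))
    (finite_compl_of_isUpperSet (isUpperSet_leadExps _ _) (Fin.addCases (fun i => ?_) fun j => ?_))
  · obtain ⟨N, hN⟩ := hpow i
    exact ⟨N, hQ.mem_leadExps_sup_tailIdeal_iff.2 (Or.inl hN)⟩
  · exact ⟨1, hQ.mem_leadExps_sup_tailIdeal_iff.2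
      (Or.inr ⟨Fin.natAdd c j, Nat.le_add_right c j, by simp⟩)⟩

theorem single_natAdd_eq_joinExp (j : Fin d) (M : ℕ) :
    Finsupp.single (Fin.natAdd c j) M =
      joinExp finSumFinEquiv.symm ((0 : Fin c →₀ ℕ), Finsupp.single j M) := by
  rw [joinExp_single_right, Equiv.symm_symm, finSumFinEquiv_apply_right]

variable [NeZero d] {u : Fin c →₀ ℕ} {N : ℕ} {E : Set (Fin (c + d) →₀ ℕ)}

/-- `E` is the set of exponents of a monomial ideal generated by monomials in the first `c`
variables and by one further monomial, with exponent `u` in the first `c` variables and `N` in the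
next one. -/
structure IsAlmostCylinder (u : Fin c →₀ ℕ) (N : ℕ) (E : Set (Fin (c + d) →₀ ℕ)) : Prop where
  isUpperSet : IsUpperSet E
  notMem_sectionExps : u ∉ sectionExps finSumFinEquiv.symm E
  joinExp_mem_iff : ∀ (v : Fin c →₀ ℕ) (t : Fin d →₀ ℕ), joinExp finSumFinEquiv.symm (v, t) ∈ E ↔
    v ∈ sectionExps finSumFinEquiv.symm E ∨ v = u ∧ N ≤ t 0

theorem isAlmostCylinder_of_diff_eq_singleton (hE : IsUpperSet E)
    (hu : projExps finSumFinEquiv.symm E \ sectionExps finSumFinEquiv.symm E = {u})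
    (hN : ∀ t : Fin d →₀ ℕ, joinExp finSumFinEquiv.symm (u, t) ∈ E ↔ N ≤ t 0) :
    IsAlmostCylinder u N E where
  isUpperSet := hE
  notMem_sectionExps := (hu.ge rfl).2
  joinExp_mem_iff v t := by
    refine ⟨fun h => or_iff_not_imp_left.2 fun hv => ?_, ?_⟩
    · obtain rfl : v = u := hu.le ⟨⟨t, h⟩, hv⟩
      exact ⟨rfl, (hN t).1 h⟩
    · rintro (hv | ⟨rfl, ht⟩)
      · exact hE ((joinExp_le_joinExp _).2 ⟨le_rfl, zero_le⟩) hv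
      · exact (hN t).2 ht

namespace IsAlmostCylinder

variable (h : IsAlmostCylinder u N E)
include h

theorem joinExp_single_mem : joinExp finSumFinEquiv.symm (u, Finsupp.single (0 : Fin d) N) ∈ E :=
  (h.joinExp_mem_iff _ _).2 (Or.inr ⟨rfl, Finsupp.single_eq_same.ge⟩)

theorem ne_zero : N ≠ 0 := by
  rintro rfl
  exact h.notMem_sectionExps ((h.joinExp_mem_iff u 0).2 (Or.inr ⟨rfl, le_rfl⟩))

theorem exists_minimal_apply_ne_zero :
    ∃ i : Fin (c + d), (i : ℕ) = c ∧ ∃ w, Minimal (· ∈ E) w ∧ w i ≠ 0 := by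
  refine ⟨Fin.natAdd c 0, by simp, _, ⟨h.joinExp_single_mem, fun w hw hle => ?_⟩,
    ((joinExp_apply_inr finSumFinEquiv.symm u _ 0).trans Finsupp.single_eq_same).trans_ne h.ne_zero⟩
  obtain ⟨⟨v, t⟩, rfl⟩ := (joinExp finSumFinEquiv.symm).surjective w
  rw [joinExp_le_joinExp] at hle
  rcases (h.joinExp_mem_iff v t).1 hw with hv | ⟨rfl, ht⟩
  · exact absurd (isUpperSet_sectionExps h.isUpperSet hle.1 hv) h.notMem_sectionExps
  · exact (joinExp_le_joinExp _).2 ⟨le_rfl, Finsupp.single_le_iff.2 ht⟩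

theorem exists_le_of_mem {w : Fin (c + d) →₀ ℕ} (hw : w ∈ E) :
    ∃ v ∈ E, v ≤ w ∧ ∀ i, v i ≠ 0 → (i : ℕ) < c + 1 := by
  obtain ⟨⟨v, t⟩, rfl⟩ := (joinExp finSumFinEquiv.symm).surjective w
  rcases (h.joinExp_mem_iff v t).1 hw with hv | ⟨rfl, ht⟩
  · refine ⟨_, hv, (joinExp_le_joinExp _).2 ⟨le_rfl, zero_le⟩, Fin.addCases (fun i _ => ?_)
      fun j hj => absurd (joinExp_apply_inr finSumFinEquiv.symm v (0 : Fin d →₀ ℕ) j) hj⟩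
    rw [Fin.val_castAdd]
    omega
  · refine ⟨_, h.joinExp_single_mem,
      (joinExp_le_joinExp _).2 ⟨le_rfl, Finsupp.single_le_iff.2 ht⟩,
      Fin.addCases (fun i _ => ?_) fun j hj => ?_⟩
    · rw [Fin.val_castAdd]
      omega
    · have : j = 0 := by
        by_contra hj0
        exact hj ((joinExp_apply_inr finSumFinEquiv.symm v _ j).trans (Finsupp.single_eq_of_ne hj0))
      simp [this]

theorem mem_of_add_single_mem {j : Fin d} (hj : j ≠ 0) {w : Fin (c + d) →₀ ℕ}
    (hw : w + Finsupp.single (Fin.natAdd c j) 1 ∈ E) : w ∈ E := by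
  obtain ⟨⟨v, t⟩, rfl⟩ := (joinExp finSumFinEquiv.symm).surjective w
  rw [single_natAdd_eq_joinExp, ← map_add, Prod.mk_add_mk, add_zero, h.joinExp_mem_iff,
    Finsupp.add_apply, Finsupp.single_eq_of_ne hj.symm, add_zero] at hw
  exact (h.joinExp_mem_iff v t).2 hw

theorem exists_notMem_add_single_mem : ∃ s : Fin (c + d), (s : ℕ) = c ∧
    ∃ w ∉ E, w + Finsupp.single s 1 ∈ E ∧ ∀ l, s < l → w l = 0 := by
  obtain ⟨N, rfl⟩ := Nat.exists_eq_succ_of_ne_zero h.ne_zero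
  refine ⟨Fin.natAdd c 0, by simp, joinExp finSumFinEquiv.symm (u, Finsupp.single (0 : Fin d) N),
    ?_, ?_, Fin.addCases (fun i hi => ?_) fun j hj => ?_⟩
  · simp [h.joinExp_mem_iff, h.notMem_sectionExps]
  · rw [single_natAdd_eq_joinExp, ← map_add, Prod.mk_add_mk, add_zero, ← Finsupp.single_add]
    exact h.joinExp_single_mem
  · exact absurd hi (by simp [Fin.lt_def])
  · refine (joinExp_apply_inr finSumFinEquiv.symm u _ j).trans (Finsupp.single_eq_of_ne ?_)
    rintro rfl
    exact lt_irrefl _ hj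

variable (k) in
theorem restrictSupportIdeal_eq_span_inter_supported :
    restrictSupportIdeal k E h.isUpperSet =
      Ideal.span ((restrictSupportIdeal k E h.isUpperSet : Set (MvPolynomial (Fin (c + d)) k)) ∩
        (supported k {i : Fin (c + d) | (i : ℕ) < c + 1} :
          Set (MvPolynomial (Fin (c + d)) k))) := by
  refine le_antisymm ?_ (Ideal.span_le.2 Set.inter_subset_left)
  refine (restrictSupportIdeal_eq_span h.isUpperSet).trans_le (Ideal.span_le.2 ?_)
  rintro _ ⟨w, hw, rfl⟩
  obtain ⟨v, hv, hvw, hsupp⟩ := h.exists_le_of_mem hw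
  refine Ideal.mem_of_dvd _ (monomial_dvd_monomial.2 ⟨Or.inr hvw, dvd_rfl⟩)
    (Ideal.subset_span ⟨(monomial_mem_restrictSupportIdeal h.isUpperSet).2 hv, ?_⟩)
  rw [SetLike.mem_coe, mem_supported, vars_monomial one_ne_zero]
  exact fun i hi => hsupp i (Finsupp.mem_support_iff.1 hi)

end IsAlmostCylinder

theorem IsHomogeneousIdeal.hasMaximalRegularSequence_of_isAlmostCylinder
    (hQ : IsHomogeneousIdeal Q)
    (hpow : ∀ i : Fin c, ∃ N, Finsupp.single (Fin.castAdd d i) N ∈ leadExps (degRevLex (c + d)) Q)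
    (h : IsAlmostCylinder u N (leadExps (degRevLex (c + d)) Q)) {t : ℕ} (ht : t + 1 = d) :
    HasMaximalRegularSequence (idealOfVars (Fin (c + d)) k) t Q := by
  obtain ⟨s, hs, w, hw, hws, hwtail⟩ := h.exists_notMem_add_single_mem
  have hsocle : HasSocle (idealOfVars (Fin (c + d)) k) (Q ⊔ tailIdeal k (c + d) (c + 1)) := by
    have hX := hQ.not_isSMulRegular_X_sup_tailIdeal hw hws hwtail
    have hsup := tailIdeal_succ_sup (k := k) s
    rw [hs] at hX hsup
    refine hasSocle_of_not_isSMulRegular hX ?_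
    rw [sup_assoc, hsup]
    exact hQ.idealOfVars_le_radical_sup_tailIdeal hpow
  refine hQ.hasMaximalRegularSequence (r := c + 1) (by omega) hsocle
    (Fin.addCases (fun i hi => ?_) fun j hj w => h.mem_of_add_single_mem ?_)
  · rw [Fin.val_castAdd] at hi
    omega
  · rintro rfl
    simp at hj

end AlmostCylinder

section Gin

variable {k : Type*} [Field k] {n : ℕ} {I J : Ideal (MvPolynomial (Fin n) k)}

theorem initialIdeal_eq_restrictSupportIdeal :
    initialIdeal I =
      restrictSupportIdeal k (leadExps (degRevLex n) I) (isUpperSet_leadExps _ I) := by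
  rw [restrictSupportIdeal_eq_span, initialIdeal]
  congr 1
  ext p
  exact ⟨fun ⟨f, hf, hf0, hp⟩ => ⟨_, ⟨f, hf, hf0, rfl⟩, hp.symm⟩,
    fun ⟨_, ⟨f, hf, hf0, hw⟩, hp⟩ => ⟨f, hf, hf0, hw ▸ hp.symm⟩⟩

theorem restrictSupportIdeal_empty :
    restrictSupportIdeal k (∅ : Set (Fin n →₀ ℕ)) isUpperSet_empty = ⊥ := by
  rw [restrictSupportIdeal_eq_span, Set.image_empty, Ideal.span_empty]

theorem deg_bot : deg (⊥ : Ideal (MvPolynomial (Fin n) k)) = 1 := by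
  rw [← restrictSupportIdeal_empty, deg_restrictSupportIdeal isUpperSet_empty (B := {0})
    (e := (Equiv.emptySum Empty (Fin n)).symm) (by simp [Subsingleton.elim _ (0 : Empty →₀ ℕ)])]
  rfl

theorem Phi_bot (r : ℕ) : Phi r (⊥ : Ideal (MvPolynomial (Fin n) k)) = ⊥ := by
  refine Ideal.span_eq_bot.2 ?_
  rintro _ ⟨u, hu, -⟩
  exact absurd hu.1 (mt monomial_eq_zero.1 one_ne_zero)

-- Were there no generic initial ideal, `gin I` would be the default value `⊥`.
theorem isGin_gin_of_deg_ne {r : ℕ} (h : deg (Phi r (gin I)) ≠ deg ((gin I).map (piHom k n r))) :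
    IsGin I (gin I) := by
  by_cases hg : ∃ J, IsGin I J
  · rw [gin, dif_pos hg]
    exact hg.choose_spec
  · rw [gin, dif_neg hg, Phi_bot, Ideal.map_bot, deg_bot, deg_bot] at h
    exact absurd rfl h

theorem IsGin.exists_hasLeadExpsOn (h : IsGin I J) :
    ∃ (U : Set (GL (Fin n) k)) (E : Set (Fin n →₀ ℕ)) (hE : IsUpperSet E),
      U.Nonempty ∧ HasLeadExpsOn U I E ∧ J = restrictSupportIdeal k E hE := by
  obtain ⟨U, hU, ⟨α, hα⟩, hUJ⟩ := h
  refine ⟨U, _, isUpperSet_leadExps (degRevLex n) (I.map (coordChange α)), ⟨α, hα⟩,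
    ⟨hU, fun β hβ => ?_⟩, ?_⟩
  · have := (hUJ β hβ).trans (hUJ α hα).symm
    rw [initialIdeal_eq_restrictSupportIdeal, initialIdeal_eq_restrictSupportIdeal] at this
    rw [← leadExps_restrictSupportIdeal (k := k) (m := degRevLex n) (isUpperSet_leadExps _ _), this,
      leadExps_restrictSupportIdeal]
  · rw [← hUJ α hα, initialIdeal_eq_restrictSupportIdeal]

theorem mem_minGens_restrictSupportIdeal_iff {E : Set (Fin n →₀ ℕ)} (hE : IsUpperSet E)
    {w : Fin n →₀ ℕ} : w ∈ minGens (restrictSupportIdeal k E hE) ↔ Minimal (· ∈ E) w := by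
  simp only [minGens, Set.mem_ofPred_eq, monomial_mem_restrictSupportIdeal]

theorem IsHomogeneousIdeal.le_idealOfVars (hI : IsHomogeneousIdeal I) (hne : I ≠ ⊤) :
    I ≤ idealOfVars (Fin n) k := by
  intro f hf
  rw [mem_idealOfVars_iff]
  by_contra h0
  have hC := homogeneousComponent_mem_of_mem hI hf 0
  rw [homogeneousComponent_zero] at hC
  exact hne (Ideal.eq_top_of_isUnit_mem _ hC ((IsUnit.mk0 _ h0).map C))

theorem depthQuot_eq_of_hasMaximalRegularSequence_map_coordChange
    (hI : I ≤ idealOfVars (Fin n) k) {α : GL (Fin n) k} {t : ℕ}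
    (h : HasMaximalRegularSequence (idealOfVars (Fin n) k) t (I.map (coordChange α))) :
    depthQuot I = t := by
  refine depthQuot_eq_of_hasMaximalRegularSequence hI ?_
  have hvars :
      (idealOfVars (Fin n) k).map (coordEquiv α⁻¹).toRingEquiv = idealOfVars (Fin n) k := by
    ext f
    obtain ⟨f, rfl⟩ := (coordEquiv α⁻¹).surjective f
    exact coordChange_mem_map_iff.trans (coordChange_mem_idealOfVars_iff _ _).symm
  have := h.map_equiv (coordEquiv α⁻¹).toRingEquiv
  rw [hvars] at this
  exact map_coordChange_inv I α ▸ this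

theorem IsHomogeneousIdeal.depthQuot_add_one_eq_of_isAlmostCylinder {c d : ℕ} [NeZero d]
    {I : Ideal (MvPolynomial (Fin (c + d)) k)} (hI : IsHomogeneousIdeal I) (hne : I ≠ ⊤)
    {α : GL (Fin (c + d)) k} {E : Set (Fin (c + d) →₀ ℕ)}
    (hE : leadExps (degRevLex (c + d)) (I.map (coordChange α)) = E)
    (hpow : ∀ i : Fin c, ∃ N, Finsupp.single (Fin.castAdd d i) N ∈ E)
    {u : Fin c →₀ ℕ} {N : ℕ} (h : IsAlmostCylinder u N E) : depthQuot I + 1 = d := by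
  subst hE
  obtain ⟨t, ht⟩ := Nat.exists_eq_succ_of_ne_zero (NeZero.ne d)
  have hreg := (hI.map_coordChange α).hasMaximalRegularSequence_of_isAlmostCylinder hpow h ht.symm
  rw [depthQuot_eq_of_hasMaximalRegularSequence_map_coordChange (hI.le_idealOfVars hne) hreg, ht,
    Nat.cast_succ]

theorem IsUnmixed.of_isPrime {R : Type*} [CommRing R] {I : Ideal R} (hI : I.IsPrime) :
    IsUnmixed I := by
  intro p hp
  rw [IsAssociatedPrime.eq_radical hI.isPrimary hp, hI.radical]

theorem ne_zero_of_projExps_diff_sectionExps_eq_singleton {c d : ℕ} {u : Fin c →₀ ℕ}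
    {E : Set (Fin (c + d) →₀ ℕ)}
    (hu : projExps finSumFinEquiv.symm E \ sectionExps finSumFinEquiv.symm E = {u}) : d ≠ 0 := by
  rintro rfl
  obtain ⟨⟨t, ht⟩, hu'⟩ := hu.ge rfl
  obtain rfl := Subsingleton.elim t 0
  exact hu' ht

end Gin

end GinDepth

end

theorem mainTheorem2_general {k : Type*} [Field k] [Infinite k] (n d c : ℕ)
    (I : Ideal (MvPolynomial (Fin n) k)) (hI : GinDepth.IsUnmixed I)
    (hhom : GinDepth.IsHomogeneousIdeal I)
    (hd : ringKrullDim (MvPolynomial (Fin n) k ⧸ I) = (d : WithBot ℕ∞))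
    (hc : c + d = n)
    (J : Ideal (MvPolynomial (Fin n) k)) (hJ : J = GinDepth.gin I)
    (hdeg : GinDepth.deg (GinDepth.Phi c J) + 1 =
      GinDepth.deg (J.map (GinDepth.piHom k n c))) :
    J = Ideal.span ((J : Set (MvPolynomial (Fin n) k)) ∩
        (MvPolynomial.supported k {i : Fin n | (i : ℕ) < c + 1} :
          Set (MvPolynomial (Fin n) k))) ∧
      (∃ i : Fin n, (i : ℕ) = c ∧ ∃ u ∈ GinDepth.minGens J, u i ≠ 0) ∧
      GinDepth.depthQuot I + 1 = (d : ℕ∞) ∧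
      GinDepth.IsAlmostCohenMacaulay I := by
  subst hc hJ
  obtain ⟨U, E, hE, ⟨α, hα⟩, hU, hJ⟩ := (GinDepth.isGin_gin_of_deg_ne
    (r := c) (I := I) (by omega)).exists_hasLeadExpsOn
  rw [hJ] at hdeg ⊢
  have hpow : ∀ i : Fin c, ∃ N, Finsupp.single (Fin.castAdd d i) N ∈ E := fun i =>
    hU.exists_single_mem_of_lt ⟨α, hα⟩ rfl hd _ i.2
  obtain ⟨u, hu⟩ := GinDepth.exists_projExps_diff_sectionExps_eq_singleton hE
    (GinDepth.sectionExps_compl_finite _ hE hpow) hdeg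
  have : NeZero d := ⟨GinDepth.ne_zero_of_projExps_diff_sectionExps_eq_singleton hu⟩
  have hEα := hU.leadExps_eq α hα
  obtain ⟨N, hN⟩ := hU.exists_forall_joinExp_mem_iff hα
    (fun a ha f => hI.mem_of_inclRight_mul_mem hd (hEα ▸ hpow) ha) hu
  have hcyl := GinDepth.isAlmostCylinder_of_diff_eq_singleton hE hu hN
  have hne : I ≠ ⊤ := by
    rintro rfl
    simp [ringKrullDim_eq_bot_of_subsingleton] at hd
  have hdepth := hhom.depthQuot_add_one_eq_of_isAlmostCylinder hne hEα hpow hcyl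
  refine ⟨hcyl.restrictSupportIdeal_eq_span_inter_supported k, ?_, hdepth, ?_⟩
  · simpa only [GinDepth.mem_minGens_restrictSupportIdeal_iff]
      using hcyl.exists_minimal_apply_ne_zero
  · rw [GinDepth.IsAlmostCohenMacaulay, hd, hdepth]
    rfl

theorem mainTheorem2 {k : Type*} [Field k] [Infinite k] (n d c : ℕ)
    (P : Ideal (MvPolynomial (Fin n) k)) (hP : P.IsPrime)
    (hhom : GinDepth.IsHomogeneousIdeal P)
    (hd : ringKrullDim (MvPolynomial (Fin n) k ⧸ P) = (d : WithBot ℕ∞))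
    (hc : c + d = n)
    (J : Ideal (MvPolynomial (Fin n) k)) (hJ : J = GinDepth.gin P)
    (hdeg : GinDepth.deg (GinDepth.Phi c J) + 1 =
      GinDepth.deg (J.map (GinDepth.piHom k n c))) :
    J = Ideal.span ((J : Set (MvPolynomial (Fin n) k)) ∩
        (MvPolynomial.supported k {i : Fin n | (i : ℕ) < c + 1} :
          Set (MvPolynomial (Fin n) k))) ∧
      (∃ i : Fin n, (i : ℕ) = c ∧ ∃ u ∈ GinDepth.minGens J, u i ≠ 0) ∧
      GinDepth.depthQuot P + 1 = (d : ℕ∞) ∧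
      GinDepth.IsAlmostCohenMacaulay P :=
  mainTheorem2_general n d c P (.of_isPrime hP) hhom hd hc J hJ hdeg
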